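/- Conventions. Graphs are finite and connected; loops and multiple edges are allowed. An embedding of a graph is a cellular embedding in an oriented closed surface, given combinatorially by a rotation system. All sequences are sequences of non-negative integers indexed by $k\in\mathbb Z$; a partial genus distribution has the entry $0$ at negative indices. A sequence $(a_k)$ is log-concave if $a_{k-1}a_{k+1}\le a_k^2$ for all $k$, and it has no internal zeros if $i<k<j$ and $a_ia_j\ne 0$ imply $a_k\neq 0$. We write $A\lesssim B$ if $A=(a_k)$ and $B=(b_k)$ are log-concave and for all $k$ $$a_{k-1}b_{k+1}\le a_kb_k,\qquad a_{k+1}b_{k-1}\le a_kb_k,\qquad a_{k+1}b_k\le a_kb_{k+1}.$$ The offset sequence is $A^+=(a_{k-1})_k$. An inequality $\frac pq\le\frac uv$ between quotients of non-negative numbers is read as $pv\le uq$ (so it holds by default if one of the quotients is $\frac00$). An edge-rooted graph $(G,e)$ is a graph with a root edge $e$ that has two distinct endpoints, both $2$-valent. A doubly edge-rooted graph $(H,g,f)$ has two root edges $g,f$ of this kind with no common endpoint. $D_{(G,e)}$ (respectively $S_{(G,e)}$) is the sequence whose $i$-th entry is the number of embeddings of $G$ in the oriented surface of genus $i$ such that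 two different face-boundary walks are incident on $e$ (respectively a single one is twice incident on $e$); $\Gamma(G)=D_{(G,e)}+S_{(G,e)}$ is the genus distribution. For $(H,g,f)$, the embeddings are classified as $DD,DS,SD,SS$, the first letter being the type ($D$ or $S$) at $g$ and the second that at $f$. The classes are refined by the number of face-boundary walks that are incident both on $g$ and on $f$: $DD^0,DD',DD''$ (none, one, two such walks), $DS^0,DS'$ and $SD^0,SD'$ (none, one), $SS^0$ (none), and $SS^1,SS^2$ (one such walk; in $SS^2$ the occurrences of $g$ and $f$ on it alternate cyclically, $g\,f\,g\,f$, and in $SS^1$ they do not). The same symbols denote the corresponding counting sequences by genus. With all sequences taken for $(H,g,f)$, put $$\begin{aligned}A_1&=DD^{0+}+DD'^{+}+SS^2+SD,&\qquad A_2&=SD+DD,\\ B_1&=DS^{+}+DD''^{+}+SS^0+SS^1,& B_2&=SS+DS,\end{aligned}$$ and write $a_{i,t}$, $b_{i,t}$ for the entries of $A_i$, $B_i$. The edge-amalgamation $(G,e)*(H,g,f)$ is the edge-rooted graph $(W,f)$ where $W$ is obtained from the disjoint union $G\sqcup H$ by merging $e$ with $g$, in either of the two possible ways. Statement. Let $(G,e)$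 be an edge-rooted graph such that $D_{(G,e)}\lesssim S_{(G,e)}$ (in particular both are log-concave). Let $\bigl((H_k,g_k,f_k)\bigr)_{k=1}^n$, $n\ge 0$, be doubly edge-rooted graphs such that for each $k$ the sequences $A_1,A_2,B_1,B_2$ of $(H_k,g_k,f_k)$ satisfy $$\frac{b_{1,t}}{a_{1,t}}\le\frac{b_{2,t}}{a_{2,t}}\le\frac{b_{1,t+1}}{a_{1,t+1}}\qquad\text{and}\qquad\frac{a_{1,t-1}}{b_{1,t}}\le\frac{a_{2,t-1}}{b_{2,t}}\le\frac{a_{1,t}}{b_{1,t+1}}\qquad\text{for all }t,$$ and such that $A_1,A_2$ are not both the zero sequence and $B_1,B_2$ are not both the zero sequence. Then for the iterated edge-amalgamation $$(W_n,f_n)=(G,e)*(H_1,g_1,f_1)*\cdots*(H_n,g_n,f_n)$$ (each merging being done in either way) the partial genus distributions $D_{(W_n,f_n)}$ and $S_{(W_n,f_n)}$ are log-concave without internal zeros, $D_{(W_n,f_n)}\lesssim S_{(W_n,f_n)}$, and the genus distribution $\Gamma(W_n)$ is log-concave without internal zeros. -/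

import Mathlib

/-! ### Graphs -/

/-- A finite connected graph; loops and multiple edges are allowed. Each edge consists of two darts
(its two orientations), interchanged by the fixed-point-free involution `rev`, and `src d` is the
vertex at which the dart `d` starts. -/
structure MultiGraph where
  V : Type
  Dart : Type
  finV : Finite V
  finDart : Finite Dart
  src : Dart → V
  rev : Dart → Dart
  rev_rev : ∀ d, rev (rev d) = d
  rev_ne : ∀ d, rev d ≠ d
  connected : ∀ v w, Relation.ReflTransGen (fun a b => ∃ d, src d = a ∧ src (rev d) = b) v w

namespace MultiGraph

/-- The valence of a vertex (a loop counts twice). -/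
noncomputable def valence (G : MultiGraph) (v : G.V) : ℕ := Nat.card {d : G.Dart // G.src d = v}

/-- `d` is (an orientation of) an edge with two distinct endpoints, both of them 2-valent. -/
def IsRootEdge (G : MultiGraph) (d : G.Dart) : Prop :=
  G.src d ≠ G.src (G.rev d) ∧ G.valence (G.src d) = 2 ∧ G.valence (G.src (G.rev d)) = 2

/-- The edges spanned by `d` and `d'` have no endpoint in common. -/
def DisjointEdges (G : MultiGraph) (d d' : G.Dart) : Prop :=
  G.src d ≠ G.src d' ∧ G.src d ≠ G.src (G.rev d') ∧
    G.src (G.rev d) ≠ G.src d' ∧ G.src (G.rev d) ≠ G.src (G.rev d')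

/-! ### Cellular embeddings in oriented surfaces -/

/-- A rotation system: a permutation of the darts whose cycles are exactly the sets of darts
starting at a common vertex. Rotation systems are the combinatorially distinct cellular embeddings
of the graph in oriented surfaces. -/
structure Embedding (G : MultiGraph) where
  rot : Equiv.Perm G.Dart
  sameCycle_iff : ∀ d d', rot.SameCycle d d' ↔ G.src d = G.src d'

/-- Reversal of darts, as a permutation. -/
def revPerm (G : MultiGraph) : Equiv.Perm G.Dart where
  toFun := G.rev
  invFun := G.rev
  left_inv := G.rev_rev
  right_inv := G.rev_rev

namespace Embedding

variable {G : MultiGraph} (ρ : Embedding G)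

/-- The face-tracing permutation: after traversing `d`, a face-boundary walk continues with the
dart that follows `rev d` in the rotation at the end vertex of `d`. -/
def next : Equiv.Perm G.Dart := ρ.rot * G.revPerm

/-- The face-boundary walks: the cycles of the face-tracing permutation. -/
def Face : Type := Quotient (Equiv.Perm.SameCycle.setoid ρ.next)

/-- The face-boundary walk that traverses the dart `d`. -/
def face (d : G.Dart) : ρ.Face := Quotient.mk (Equiv.Perm.SameCycle.setoid ρ.next) d

/-- The embedding surface has genus `i`: Euler's formula `V - E + F = 2 - 2 i`, where the number of
edges is half the number of darts. -/
def HasGenus (i : ℤ) : Prop :=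
  (Nat.card G.V : ℤ) - (Nat.card G.Dart / 2 : ℕ) + Nat.card ρ.Face = 2 - 2 * i

/-- Type `d` at the edge `e`: two different face-boundary walks are incident on `e`. -/
def TypeD (e : G.Dart) : Prop := ρ.face e ≠ ρ.face (G.rev e)

/-- Type `s` at the edge `e`: a single face-boundary walk is twice incident on `e`. -/
def TypeS (e : G.Dart) : Prop := ρ.face e = ρ.face (G.rev e)

/-- The number of face-boundary walks that are incident both on `g` and on `f`. -/
noncomputable def shared (g f : G.Dart) : ℕ :=
  (({ρ.face g, ρ.face (G.rev g)} : Set ρ.Face) ∩ {ρ.face f, ρ.face (G.rev f)}).ncard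

/-- `x` occurs on the face-boundary walk that starts with `a`, before the walk first reaches `b`. -/
def Between (a x b : G.Dart) : Prop :=
  ∃ m n : ℕ, m < n ∧ (ρ.next ^ m) a = x ∧ (ρ.next ^ n) a = b ∧ ∀ j < n, (ρ.next ^ j) a ≠ b

/-- For edges `g`, `f` both of whose sides lie on one face-boundary walk: the occurrences of `g`
and of `f` on that walk alternate, in the cyclic pattern `g f g f`. -/
def Alternating (g f : G.Dart) : Prop :=
  Xor (ρ.Between g f (G.rev g)) (ρ.Between g (G.rev f) (G.rev g))

end Embedding

/-- The number of embeddings in the surface of genus `i` that satisfy `P`, as a sequence indexed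
by the integers `i`. -/
noncomputable def count (G : MultiGraph) (P : Embedding G → Prop) (i : ℤ) : ℕ :=
  Nat.card {ρ : Embedding G // ρ.HasGenus i ∧ P ρ}

/-- The genus distribution. -/
noncomputable def genusDist (G : MultiGraph) : ℤ → ℕ := G.count fun _ => True

end MultiGraph

/-! ### Rooted graphs and their partial genus distributions -/

/-- A graph with a root edge that has two 2-valent endpoints. The root is given as a dart, that is,
with one of its two orientations. -/
structure EdgeRooted extends MultiGraph where
  e : Dart
  isRoot : toMultiGraph.IsRootEdge e

/-- A graph with two root edges without common endpoints, all four endpoints being 2-valent. -/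
structure DoublyEdgeRooted extends MultiGraph where
  g : Dart
  f : Dart
  isRoot_g : toMultiGraph.IsRootEdge g
  isRoot_f : toMultiGraph.IsRootEdge f
  disjoint : toMultiGraph.DisjointEdges g f

namespace EdgeRooted

variable (G : EdgeRooted)

/-- `D_(G,e)`. -/
noncomputable def D : ℤ → ℕ := G.count fun ρ => ρ.TypeD G.e

/-- `S_(G,e)`. -/
noncomputable def S : ℤ → ℕ := G.count fun ρ => ρ.TypeS G.e

end EdgeRooted

/-- The offset sequence `a⁺`. -/
def offset (a : ℤ → ℕ) : ℤ → ℕ := fun k => a (k - 1)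

namespace DoublyEdgeRooted

variable (H : DoublyEdgeRooted)

/-! The ten double-root partial genus distributions. -/

noncomputable def DD0 : ℤ → ℕ :=
  H.count fun ρ => ρ.TypeD H.g ∧ ρ.TypeD H.f ∧ ρ.shared H.g H.f = 0
noncomputable def DD1 : ℤ → ℕ :=
  H.count fun ρ => ρ.TypeD H.g ∧ ρ.TypeD H.f ∧ ρ.shared H.g H.f = 1
noncomputable def DD2 : ℤ → ℕ :=
  H.count fun ρ => ρ.TypeD H.g ∧ ρ.TypeD H.f ∧ ρ.shared H.g H.f = 2
noncomputable def DS0 : ℤ → ℕ :=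
  H.count fun ρ => ρ.TypeD H.g ∧ ρ.TypeS H.f ∧ ρ.shared H.g H.f = 0
noncomputable def DS1 : ℤ → ℕ :=
  H.count fun ρ => ρ.TypeD H.g ∧ ρ.TypeS H.f ∧ ρ.shared H.g H.f = 1
noncomputable def SD0 : ℤ → ℕ :=
  H.count fun ρ => ρ.TypeS H.g ∧ ρ.TypeD H.f ∧ ρ.shared H.g H.f = 0
noncomputable def SD1 : ℤ → ℕ :=
  H.count fun ρ => ρ.TypeS H.g ∧ ρ.TypeD H.f ∧ ρ.shared H.g H.f = 1
noncomputable def SS0 : ℤ → ℕ :=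
  H.count fun ρ => ρ.TypeS H.g ∧ ρ.TypeS H.f ∧ ρ.shared H.g H.f = 0
noncomputable def SS1 : ℤ → ℕ :=
  H.count fun ρ => ρ.TypeS H.g ∧ ρ.TypeS H.f ∧ ρ.shared H.g H.f = 1 ∧ ¬ ρ.Alternating H.g H.f
noncomputable def SS2 : ℤ → ℕ :=
  H.count fun ρ => ρ.TypeS H.g ∧ ρ.TypeS H.f ∧ ρ.shared H.g H.f = 1 ∧ ρ.Alternating H.g H.f

/-! The groupings. -/

noncomputable def DD : ℤ → ℕ := H.DD0 + H.DD1 + H.DD2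
noncomputable def DS : ℤ → ℕ := H.DS0 + H.DS1
noncomputable def SD : ℤ → ℕ := H.SD0 + H.SD1
noncomputable def SS : ℤ → ℕ := H.SS0 + H.SS1 + H.SS2

/-! The four combinations that enter the hypothesis on the amalgamands. -/

noncomputable def A1 : ℤ → ℕ := offset H.DD0 + offset H.DD1 + H.SS2 + H.SD
noncomputable def A2 : ℤ → ℕ := H.SD + H.DD
noncomputable def B1 : ℤ → ℕ := offset H.DS + offset H.DD2 + H.SS0 + H.SS1
noncomputable def B2 : ℤ → ℕ := H.SS + H.DS

end DoublyEdgeRooted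

/-! ### Log-concavity, synchronicity, ratio-dominance -/

def LogConcave (a : ℤ → ℕ) : Prop := ∀ k, a (k - 1) * a (k + 1) ≤ a k ^ 2

def NoInternalZeros (a : ℤ → ℕ) : Prop := ∀ i k j, i < k → k < j → a i * a j ≠ 0 → a k ≠ 0

def Synchronized (a b : ℤ → ℕ) : Prop :=
  LogConcave a ∧ LogConcave b ∧
    ∀ k, a (k - 1) * b (k + 1) ≤ a k * b k ∧ a (k + 1) * b (k - 1) ≤ a k * b k

/-- `a ≲ b`: `b` is ratio-dominant over `a`. -/
def RatioDominated (a b : ℤ → ℕ) : Prop :=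
  Synchronized a b ∧ ∀ k, a (k + 1) * b k ≤ a k * b (k + 1)

/-- `p / q ≤ u / v` in the extended sense for nonnegative terms: a quotient with positive numerator
and zero denominator is `+∞`, and the inequality holds by default if one of the two quotients
is `0 / 0`. -/
def RatioLE (p q u v : ℕ) : Prop := p * v ≤ u * q

/-- The functions `b_{i,t} / a_{i,t}` and `a_{i,t-1} / b_{i,t}` (`i = 1, 2`) are lexicographic. -/
def LexCondition (a₁ a₂ b₁ b₂ : ℤ → ℕ) : Prop :=
  ∀ t, (RatioLE (b₁ t) (a₁ t) (b₂ t) (a₂ t) ∧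
      RatioLE (b₂ t) (a₂ t) (b₁ (t + 1)) (a₁ (t + 1))) ∧
    (RatioLE (a₁ (t - 1)) (b₁ t) (a₂ (t - 1)) (b₂ t) ∧
      RatioLE (a₂ (t - 1)) (b₂ t) (a₁ t) (b₁ (t + 1)))

/-! ### Edge-amalgamation -/

namespace Amalgam

open scoped Classical

variable (G : EdgeRooted) (H : DoublyEdgeRooted)

/-- The vertices of the amalgamated graph: the endpoints of `g` are merged with those of `e`. -/
abbrev Vert : Type := G.V ⊕ {v : H.V // v ≠ H.src H.g ∧ v ≠ H.src (H.rev H.g)}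

/-- The darts of the amalgamated graph: the edge `g` is merged with `e`. -/
abbrev Darts : Type := G.Dart ⊕ {d : H.Dart // d ≠ H.g ∧ d ≠ H.rev H.g}

/-- The vertex of the amalgamated graph that comes from a vertex of `H`. -/
noncomputable def vertH (v : H.V) : Vert G H :=
  if h₁ : v = H.src H.g then Sum.inl (G.src G.e)
  else if h₂ : v = H.src (H.rev H.g) then Sum.inl (G.src (G.rev G.e))
  else Sum.inr ⟨v, h₁, h₂⟩

noncomputable def src : Darts G H → Vert G H
  | Sum.inl d => Sum.inl (G.src d)
  | Sum.inr d => vertH G H (H.src d)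

noncomputable def rev : Darts G H → Darts G H
  | Sum.inl d => Sum.inl (G.rev d)
  | Sum.inr d => Sum.inr ⟨H.rev d.1,
      fun h => d.2.2 ((H.rev_rev d.1).symm.trans (congrArg H.rev h)),
      fun h => d.2.1 ((H.rev_rev d.1).symm.trans ((congrArg H.rev h).trans (H.rev_rev H.g)))⟩

theorem vertH_of_ne {v : H.V} (h₁ : v ≠ H.src H.g) (h₂ : v ≠ H.src (H.rev H.g)) :
    vertH G H v = Sum.inr ⟨v, h₁, h₂⟩ := by
  simp [vertH, h₁, h₂]

theorem vertH_g : vertH G H (H.src H.g) = Sum.inl (G.src G.e) := by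
  simp [vertH]

theorem vertH_rev_g : vertH G H (H.src (H.rev H.g)) = Sum.inl (G.src (G.rev G.e)) := by
  simp [vertH, H.isRoot_g.1.symm]

/-- Adjacency in the amalgamated graph. -/
def Step (a b : Vert G H) : Prop := ∃ d, src G H d = a ∧ src G H (rev G H d) = b

theorem reach_inl (v w : G.V) :
    Relation.ReflTransGen (Step G H) (Sum.inl v) (Sum.inl w) := by
  refine Relation.ReflTransGen.lift (Sum.inl : G.V → Vert G H) ?_ _ _ (G.connected v w)
  rintro a b ⟨d, rfl, rfl⟩
  exact ⟨Sum.inl d, rfl, rfl⟩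

theorem reach_vertH (v w : H.V) :
    Relation.ReflTransGen (Step G H) (vertH G H v) (vertH G H w) := by
  refine Relation.ReflTransGen.lift (vertH G H) ?_ _ _ (H.connected v w)
  rintro a b ⟨d, rfl, rfl⟩
  by_cases h₁ : d = H.g
  · subst h₁
    exact ⟨Sum.inl G.e, (vertH_g G H).symm, (vertH_rev_g G H).symm⟩
  by_cases h₂ : d = H.rev H.g
  · subst h₂
    refine ⟨Sum.inl (G.rev G.e), (vertH_rev_g G H).symm, ?_⟩
    simp [rev, src, G.rev_rev, H.rev_rev, vertH_g]
  · exact ⟨Sum.inr ⟨d, h₁, h₂⟩, rfl, rfl⟩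

theorem exists_root_reach (a : Vert G H) :
    Relation.ReflTransGen (Step G H) a (Sum.inl (G.src G.e)) ∧
      Relation.ReflTransGen (Step G H) (Sum.inl (G.src G.e)) a := by
  rcases a with v | ⟨v, h₁, h₂⟩
  · exact ⟨reach_inl G H _ _, reach_inl G H _ _⟩
  · rw [← vertH_of_ne G H h₁ h₂, ← vertH_g G H]
    exact ⟨reach_vertH G H _ _, reach_vertH G H _ _⟩

/-- The graph obtained from the disjoint union of `G` and `H` by merging the edge `g` with the edge
`e`, the start of the dart `g` with the start of the dart `e`. -/
noncomputable def graph : MultiGraph where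
  V := Vert G H
  Dart := Darts G H
  finV := by
    have := G.finV
    have := H.finV
    infer_instance
  finDart := by
    have := G.finDart
    have := H.finDart
    infer_instance
  src := src G H
  rev := rev G H
  rev_rev := by
    rintro (d | d)
    · simp [rev, G.rev_rev]
    · simp [rev, H.rev_rev]
  rev_ne := by
    rintro (d | d)
    · simp [rev, G.rev_ne]
    · simp [rev, Subtype.ext_iff, H.rev_ne]
  connected := fun v w =>
    (exists_root_reach G H v).1.trans (exists_root_reach G H w).2

/-- The root edge `f` of `H`, as a dart of the amalgamated graph. -/
noncomputable def root : Darts G H :=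
  Sum.inr ⟨H.f, fun h => H.disjoint.1 (by rw [h]), fun h => H.disjoint.2.2.1 (by rw [h])⟩

theorem valence_eq {v : H.V} (h₁ : v ≠ H.src H.g) (h₂ : v ≠ H.src (H.rev H.g)) :
    (graph G H).valence (vertH G H v) = H.valence v := by
  symm
  let F : {d : H.Dart // H.src d = v} → {d : Darts G H // src G H d = vertH G H v} :=
    fun d => ⟨Sum.inr ⟨d.1, fun h => h₁ (by rw [← d.2, h]), fun h => h₂ (by rw [← d.2, h])⟩,
      congrArg (vertH G H) d.2⟩
  refine Nat.card_eq_of_bijective F ⟨?_, ?_⟩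
  · rintro ⟨a, ha⟩ ⟨b, hb⟩ h
    have h' := Sum.inr.inj (congrArg Subtype.val h)
    simpa using h'
  · rintro ⟨d | ⟨d, hd⟩, h⟩
    · rw [vertH_of_ne G H h₁ h₂] at h
      exact absurd h (by simp [graph, src])
    · have hd' : H.src d = v := by
        change vertH G H (H.src d) = _ at h
        rw [vertH_of_ne G H h₁ h₂] at h
        unfold vertH at h
        split_ifs at h
        simpa using h
      exact ⟨⟨d, hd'⟩, rfl⟩

theorem isRootEdge_root : (graph G H).IsRootEdge (root G H) := by
  obtain ⟨h₁, h₂, h₃, h₄⟩ := H.disjoint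
  obtain ⟨hne, hv, hv'⟩ := H.isRoot_f
  refine ⟨?_, ?_, ?_⟩
  · change vertH G H (H.src H.f) ≠ vertH G H (H.src (H.rev H.f))
    rw [vertH_of_ne G H h₁.symm h₃.symm, vertH_of_ne G H h₂.symm h₄.symm]
    simpa using hne
  · exact (valence_eq G H h₁.symm h₃.symm).trans hv
  · exact (valence_eq G H h₂.symm h₄.symm).trans hv'

end Amalgam

/-- The edge-amalgamation `(W, f) = (G, e) * (H, g, f)`. The edge `g` can be merged with the edge
`e` in two ways; the other way is the amalgamation in which the orientation of the root `g` of `H`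
is reversed. -/
noncomputable def amalgam (G : EdgeRooted) (H : DoublyEdgeRooted) : EdgeRooted where
  toMultiGraph := Amalgam.graph G H
  e := Amalgam.root G H
  isRoot := Amalgam.isRootEdge_root G H

/-- The iterated edge-amalgamation `(W_n, f_n) = (G, e) * (H_1, g_1, f_1) * ⋯ * (H_n, g_n, f_n)`. -/
noncomputable def chain (G : EdgeRooted) (Hs : List DoublyEdgeRooted) : EdgeRooted :=
  Hs.foldl amalgam G

/-! ### Cycles of permutations -/

namespace Equiv.Perm

variable {α β : Type*}

/-! At each end of the merged edge a single further dart of `H` is inserted next to one of the two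
darts of `G`. A rotation system of the amalgam is therefore a rotation system of `G`, one of `H` and
one of two positions at each end: four embeddings for each pair. Up to first return to the surviving
darts, face tracing in the amalgam is a `splice` of face tracing in `G` and in `H` with `g` removed
(`twist`). If the chosen darts `p`, `q` lie on different faces of `G`, the spliced cycles merge and
`H` contributes its `twistGenus`. If they lie on one face, `splice_swap_mul` restores the edge `g`
and `H` contributes its genus. Of the four positions, two are of the first sort at type D and none
at type S. The sequences `A1`, `B1` count embeddings of `H` by twisted genus and `A2`, `B2` by genus
(`A1_eq` and its companions), which gives the recurrence `sum_embedding_graph`.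

Interleave `A1`, `A2` to α and `B1`, `B2` to β. The new D and S are then α and β times one matrix,
`amalgamRow`, whose order-two minors in consecutive columns are nonnegative because D ≲ S before the
amalgamation. Moving one column back is the same as moving α or β by two places. The lexicographic
condition says that α_p/β_p and β_p/α_{p-2} decrease in p. Chaining these ratios gives the minors
formed by α, β and their shifts by two, and the Cauchy–Binet inequality turns them into D ≲ S for
the amalgam.

Ratios can only be chained across nonzero terms, and the control of zeros is topological.
Conjugating a rotation by a transposition changes a genus by at most one, so genera and twisted
genera fill intervals (`exists_eq_of_conj_swap_le`). Since a twisted genus is the genus or one more,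
α + β has no internal zeros. The genus distribution has none either, and ratio-dominance passes this
on to D and S separately. -/

/-- The number of cycles of a permutation, fixed points included. -/
noncomputable def numCycles (σ : Perm α) : ℕ := Nat.card (Quotient (SameCycle.setoid σ))

/-- A reflexive relation that follows the steps of `σ` contains the cycles of `σ`. -/
theorem SameCycle.rel_of_step [Finite α] {σ : Perm α} {r : α → α → Prop} (hr : ∀ x, r x x)
    (hstep : ∀ x y, r x y → r x (σ y)) {x y : α} (h : SameCycle σ x y) : r x y := by
  obtain ⟨n, rfl⟩ := h.exists_nat_pow_eq
  clear h
  induction n with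
  | zero => exact hr x
  | succ n ih => rw [pow_succ', mul_apply]; exact hstep _ _ ih

theorem numCycles_congr {σ : Perm α} {τ : Perm β} (e : α ≃ β)
    (h : ∀ x y, SameCycle σ x y ↔ SameCycle τ (e x) (e y)) : numCycles σ = numCycles τ :=
  Nat.card_congr (Quotient.congr e h)

/-! ### Merging and splitting of cycles by a transposition. -/

section Swap

variable [DecidableEq α]

theorem swap_mul_apply_of_ne {σ : Perm α} {a b x : α} (h₁ : σ x ≠ a) (h₂ : σ x ≠ b) :
    (swap a b * σ) x = σ x := by
  rw [mul_apply, swap_apply_of_ne_of_ne h₁ h₂]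

/-- Following a cycle of `σ` through `a` and not through `b`, the permutation `swap a b * σ`
leads to `b`. -/
theorem SameCycle.swap_mul_right [Finite α] {σ : Perm α} {a b x : α} (hab : ¬ SameCycle σ a b)
    (h : SameCycle σ x a) : SameCycle (swap a b * σ) x b := by
  -- The exponent has to be positive: for `x = a` the walk must go once around the cycle before it
  -- is redirected to `b`.
  obtain ⟨n, hpos, -, hn⟩ := h.exists_pow_eq''
  have key : ∀ n : ℕ, 0 < n → ∀ x, (σ ^ n) x = a → SameCycle (swap a b * σ) x b := by
    intro n
    induction n with
    | zero => intro h; exact absurd h (lt_irrefl 0)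
    | succ n ih =>
      intro _ x hx
      by_cases hxa : σ x = a
      · refine ⟨1, ?_⟩
        rw [zpow_one, mul_apply, hxa, swap_apply_left]
      · have hn : 0 < n := by
          rcases Nat.eq_zero_or_pos n with h0 | h0
          · subst h0; exact absurd (by simpa using hx) hxa
          · exact h0
        rw [pow_succ, mul_apply] at hx
        have hxb : σ x ≠ b := by
          rintro hb
          exact hab (SameCycle.symm ⟨n, by rw [← hb, zpow_natCast, hx]⟩)
        rw [← sameCycle_apply_left, swap_mul_apply_of_ne hxa hxb]
        exact ih hn _ hx
  exact key n hpos x hn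

/-- Multiplication by a transposition of points of two different cycles merges these cycles. -/
theorem sameCycle_swap_mul_iff [Finite α] {σ : Perm α} {a b : α} (hab : ¬ SameCycle σ a b)
    (x y : α) : SameCycle (swap a b * σ) x y ↔ SameCycle σ x y ∨
      ((SameCycle σ x a ∨ SameCycle σ x b) ∧ (SameCycle σ y a ∨ SameCycle σ y b)) := by
  have hb : ∀ x, SameCycle σ x a → SameCycle (swap a b * σ) x b := fun x h => h.swap_mul_right hab
  have ha : ∀ x, SameCycle σ x b → SameCycle (swap a b * σ) x a := fun x h => by
    rw [swap_comm]; exact h.swap_mul_right (fun h => hab h.symm)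
  have hba := hb a (SameCycle.refl _ _)
  constructor
  · intro h
    refine SameCycle.rel_of_step (r := fun x y => SameCycle σ x y ∨
      ((SameCycle σ x a ∨ SameCycle σ x b) ∧ (SameCycle σ y a ∨ SameCycle σ y b)))
      (fun x => Or.inl (SameCycle.refl _ _)) ?_ h
    intro x y hxy
    have hy : ∀ z, SameCycle σ y z ↔ SameCycle σ (σ y) z := fun z => sameCycle_apply_left.symm
    have hyx : SameCycle σ x (σ y) ↔ SameCycle σ x y := sameCycle_apply_right
    by_cases h1 : σ y = a
    · have : SameCycle σ y a := (hy a).2 (by rw [h1])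
      rw [mul_apply, h1, swap_apply_left]
      refine Or.inr ⟨?_, Or.inr (SameCycle.refl _ _)⟩
      rcases hxy with h | h
      · exact Or.inl (h.trans this)
      · exact h.1
    by_cases h2 : σ y = b
    · have : SameCycle σ y b := (hy b).2 (by rw [h2])
      rw [mul_apply, h2, swap_apply_right]
      refine Or.inr ⟨?_, Or.inl (SameCycle.refl _ _)⟩
      rcases hxy with h | h
      · exact Or.inr (h.trans this)
      · exact h.1
    rw [swap_mul_apply_of_ne h1 h2, hyx, ← hy, ← hy]
    exact hxy
  · have hor : ∀ x, SameCycle σ x a ∨ SameCycle σ x b → SameCycle (swap a b * σ) x b :=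
      fun x h => h.elim (hb x) fun h => (ha x h).trans hba
    rintro (h | ⟨h1, h2⟩)
    · refine SameCycle.rel_of_step (r := SameCycle (swap a b * σ)) (SameCycle.refl _) ?_ h
      intro x y hxy
      refine hxy.trans ?_
      by_cases h1 : σ y = a
      · rw [h1]
        exact (hb y (by rw [← h1, sameCycle_apply_right])).trans hba.symm
      by_cases h2 : σ y = b
      · rw [h2]
        exact hor y (Or.inr (by rw [← h2, sameCycle_apply_right]))
      rw [← swap_mul_apply_of_ne h1 h2, sameCycle_apply_right]
    · exact (hor x h1).trans (hor y h2).symm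

/-- Every cycle of the product has a representative outside the old cycle of `b`, for the merged one
the point `a`. Hence the old cycles other than that of `b` correspond to the new ones. -/
theorem numCycles_swap_mul_of_not_sameCycle [Finite α] {σ : Perm α} {a b : α}
    (hab : ¬ SameCycle σ a b) : numCycles (swap a b * σ) + 1 = numCycles σ := by
  classical
  let Q := Quotient (SameCycle.setoid σ)
  have : Finite Q := inferInstanceAs (Finite (Quotient _))
  have := Fintype.ofFinite Q
  let b' : Q := Quotient.mk (SameCycle.setoid σ) b
  let F : {q : Q // q ≠ b'} → Quotient (SameCycle.setoid (swap a b * σ)) := fun q =>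
    Quotient.map' (s₁ := SameCycle.setoid σ) (s₂ := SameCycle.setoid (swap a b * σ)) id
      (fun x y h => (sameCycle_swap_mul_iff hab x y).2 (Or.inl h)) q.1
  have hF : Function.Bijective F := by
    constructor
    · rintro ⟨⟨x⟩, hx⟩ ⟨⟨y⟩, hy⟩ h
      have hx' : ¬ SameCycle σ x b := fun h => hx (Quotient.sound (s := SameCycle.setoid σ) h)
      have hy' : ¬ SameCycle σ y b := fun h => hy (Quotient.sound (s := SameCycle.setoid σ) h)
      have h' : SameCycle (swap a b * σ) x y :=
        Quotient.exact (s := SameCycle.setoid (swap a b * σ)) h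
      refine Subtype.ext (Quotient.sound (s := SameCycle.setoid σ) ?_)
      rcases (sameCycle_swap_mul_iff hab x y).1 h' with h | ⟨h1, h2⟩
      · exact h
      · exact (h1.resolve_right hx').trans (h2.resolve_right hy').symm
    · rintro ⟨x⟩
      by_cases hx : SameCycle σ x b
      · refine ⟨⟨Quotient.mk (SameCycle.setoid σ) a, fun h => hab
          (Quotient.exact (s := SameCycle.setoid σ) h)⟩, ?_⟩
        exact Quotient.sound (s := SameCycle.setoid (swap a b * σ))
          ((sameCycle_swap_mul_iff hab a x).2
            (Or.inr ⟨Or.inl (SameCycle.refl _ _), Or.inr hx⟩))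
      · exact ⟨⟨Quotient.mk (SameCycle.setoid σ) x, fun h => hx
          (Quotient.exact (s := SameCycle.setoid σ) h)⟩, rfl⟩
  have h1 : numCycles (swap a b * σ) = Nat.card {q : Q // q ≠ b'} :=
    (Nat.card_eq_of_bijective F hF).symm
  have h2 : numCycles σ = Nat.card Q := rfl
  rw [h1, h2, Nat.card_eq_fintype_card, Nat.card_eq_fintype_card, Fintype.card_subtype_compl,
    Fintype.card_subtype_eq]
  have : 0 < Fintype.card Q := Fintype.card_pos_iff.2 ⟨b'⟩
  omega

/-- The cycle of `a` that is split off by a transposition of two points `a`, `b` of one cycle. -/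
theorem sameCycle_swap_mul_iff_between [Finite α] {σ : Perm α} {a b : α} (hne : a ≠ b)
    (hab : SameCycle σ a b) (x : α) : SameCycle (swap a b * σ) a x ↔
      ∃ m n : ℕ, m < n ∧ (σ ^ m) a = x ∧ (σ ^ n) a = b ∧ ∀ j < n, (σ ^ j) a ≠ b := by
  classical
  have hex := hab.exists_nat_pow_eq
  let n := Nat.find hex
  have hn : (σ ^ n) a = b := Nat.find_spec hex
  have hmin : ∀ j < n, (σ ^ j) a ≠ b := fun j hj => Nat.find_min hex hj
  have hpos : 0 < n := by
    rcases Nat.eq_zero_or_pos n with h | h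
    · rw [h] at hn; exact absurd hn hne
    · exact h
  have hstep : ∀ j, j + 1 < n → (swap a b * σ) ((σ ^ j) a) = (σ ^ (j + 1)) a := by
    intro j hj
    have h : σ ((σ ^ j) a) = (σ ^ (j + 1)) a := by rw [pow_succ', mul_apply]
    rw [mul_apply, h]
    refine swap_apply_of_ne_of_ne (fun h => ?_) (hmin _ hj)
    -- A return to `a` after `j + 1` steps would make `b` appear `j + 1` steps earlier, against the
    -- minimality of `n`.
    refine hmin (n - (j + 1)) (by omega) ?_
    have h' : (σ ^ (n - (j + 1) + (j + 1))) a = b := by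
      rw [Nat.sub_add_cancel (by omega)]; exact hn
    rwa [pow_add, mul_apply, h] at h'
  constructor
  · intro h
    have key := SameCycle.rel_of_step (σ := swap a b * σ) (r := fun x y => x = a →
      ∃ m < n, (σ ^ m) a = y) (fun x hx => ⟨0, hpos, hx.symm⟩) ?_ h rfl
    · obtain ⟨m, hm, h⟩ := key
      exact ⟨m, n, hm, h, hn, hmin⟩
    · rintro x y hxy hx
      obtain ⟨m, hm, rfl⟩ := hxy hx
      by_cases hm' : m + 1 < n
      · exact ⟨m + 1, hm', (hstep m hm').symm⟩
      -- At the last step `σ` reaches `b`, which the transposition sends back to `a`.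
      · have : m + 1 = n := by omega
        refine ⟨0, hpos, ?_⟩
        have h : σ ((σ ^ m) a) = b := by rw [← hn, ← this, pow_succ', mul_apply]
        rw [mul_apply, h, swap_apply_right]; rfl
  · rintro ⟨m, n', hm, rfl, hn', hmin'⟩
    have : n' = n := by
      rcases lt_trichotomy n' n with h | h | h
      · exact absurd hn' (hmin _ h)
      · exact h
      · exact absurd hn (hmin' _ h)
    subst this
    clear hn' hmin'
    induction m with
    | zero => exact SameCycle.refl _ _
    | succ m ih =>
      rw [← hstep m hm, sameCycle_apply_right]
      exact ih (by omega)

theorem not_sameCycle_swap_mul [Finite α] {σ : Perm α} {a b : α} (hne : a ≠ b)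
    (hab : SameCycle σ a b) : ¬ SameCycle (swap a b * σ) a b := by
  rw [sameCycle_swap_mul_iff_between hne hab]
  rintro ⟨m, n, hm, h, -, hmin⟩
  exact hmin m hm h

/-- A transposition is its own inverse, so splitting a cycle is merging read backwards. -/
theorem sameCycle_of_swap_mul_split [Finite α] {σ : Perm α} {a b : α} (hne : a ≠ b)
    (hab : SameCycle σ a b) (x y : α) : SameCycle σ x y ↔ SameCycle (swap a b * σ) x y ∨
      ((SameCycle (swap a b * σ) x a ∨ SameCycle (swap a b * σ) x b) ∧
        (SameCycle (swap a b * σ) y a ∨ SameCycle (swap a b * σ) y b)) := by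
  have h := sameCycle_swap_mul_iff (not_sameCycle_swap_mul hne hab) x y
  rwa [swap_mul_self_mul] at h

theorem numCycles_swap_mul_of_sameCycle [Finite α] {σ : Perm α} {a b : α} (hne : a ≠ b)
    (hab : SameCycle σ a b) : numCycles (swap a b * σ) = numCycles σ + 1 := by
  have h := numCycles_swap_mul_of_not_sameCycle (not_sameCycle_swap_mul hne hab)
  rw [swap_mul_self_mul] at h
  exact h.symm

theorem numCycles_swap_mul [Finite α] (σ : Perm α) {a b : α} (hne : a ≠ b) :
    numCycles (swap a b * σ) + 1 = numCycles σ ∨ numCycles (swap a b * σ) = numCycles σ + 1 := by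
  by_cases h : SameCycle σ a b
  · exact Or.inr (numCycles_swap_mul_of_sameCycle hne h)
  · exact Or.inl (numCycles_swap_mul_of_not_sameCycle h)

/-- Each transposition flips both the sign and the parity of the number of cycles. For the identity
the exponent is twice the cardinality. -/
theorem sign_eq_neg_one_pow_card_add_numCycles [Fintype α] (σ : Perm α) :
    sign σ = (-1) ^ (Fintype.card α + numCycles σ) := by
  induction σ using swap_induction_on with
  | one =>
    have : numCycles (1 : Perm α) = Fintype.card α := by
      rw [← Nat.card_eq_fintype_card]
      refine (Nat.card_eq_of_bijective (Quotient.mk (SameCycle.setoid (1 : Perm α)))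
        ⟨fun x y h => ?_, Quotient.mk_surjective⟩).symm
      exact sameCycle_one.1 (Quotient.exact (s := SameCycle.setoid (1 : Perm α)) h)
    rw [this, sign_one, ← two_mul, pow_mul]
    simp
  | swap_mul f x y hxy ih =>
    rw [sign_mul, sign_swap hxy, ih]
    rcases numCycles_swap_mul f hxy with h | h
    · rw [← h, ← add_assoc, pow_succ]; simp
    · rw [h, ← add_assoc, pow_succ]; simp

end Swap

/-! ### Conjugation, and interpolation between permutations with the same cycle sets. -/

theorem numCycles_conj (σ τ : Perm α) : numCycles (τ * σ * τ⁻¹) = numCycles σ := by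
  refine (numCycles_congr τ fun x y => ?_).symm
  rw [sameCycle_conj]; simp

/-- Two permutations with the same cycles, as sets, are conjugate by a permutation that preserves
each of these sets. -/
theorem exists_conj_of_sameCycle_iff [Finite α] {σ τ : Perm α}
    (h : ∀ x y, SameCycle σ x y ↔ SameCycle τ x y) :
    ∃ π : Perm α, (∀ x, SameCycle σ x (π x)) ∧ π * σ * π⁻¹ = τ := by
  classical
  have := Fintype.ofFinite α
  let base : α → α := fun x => (Quotient.mk (SameCycle.setoid σ) x).out
  have hbase : ∀ x, SameCycle σ (base x) x := fun x =>
    Quotient.exact (s := SameCycle.setoid σ) (Quotient.out_eq _)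
  have hbase' : ∀ x y, SameCycle σ x y → base x = base y := fun x y h =>
    congrArg Quotient.out (Quotient.sound (s := SameCycle.setoid σ) h)
  choose k hk using hbase
  -- On a common cycle set both permutations are cyclic of the same length, so exponents are
  -- identified in the same way. This makes the transport of `σ ^ k` at the base point to `τ ^ k` at
  -- the base point injective and equivariant.
  have hcyc : ∀ (b : α) (i j : ℤ), (σ ^ i) b = (σ ^ j) b ↔ (τ ^ i) b = (τ ^ j) b := by
    intro b i j
    let s : Finset α := {x | SameCycle σ b x}
    have hσ : σ.IsCycleOn s := by
      refine ⟨⟨fun x hx => ?_, σ.injective.injOn, fun x hx => ⟨σ⁻¹ x, ?_, by simp⟩⟩,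
        fun x hx y hy => ?_⟩
      · simpa [s, sameCycle_apply_right] using hx
      · have hx : SameCycle σ b x := by simpa [s] using hx
        simpa [s, sameCycle_symm_apply_right, inv_def] using hx
      · have hx : SameCycle σ b x := by simpa [s] using hx
        have hy : SameCycle σ b y := by simpa [s] using hy
        exact hx.symm.trans hy
    have hτ : τ.IsCycleOn s := by
      refine ⟨⟨fun x hx => ?_, τ.injective.injOn, fun x hx => ⟨τ⁻¹ x, ?_, by simp⟩⟩,
        fun x hx y hy => ?_⟩
      · have hx : SameCycle σ b x := by simpa [s] using hx
        simpa [s, h, sameCycle_apply_right] using hx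
      · have hx : SameCycle σ b x := by simpa [s] using hx
        simpa [s, h, sameCycle_symm_apply_right, inv_def] using hx
      · have hx : SameCycle σ b x := by simpa [s] using hx
        have hy : SameCycle σ b y := by simpa [s] using hy
        exact (h _ _).1 (hx.symm.trans hy)
    have hb : b ∈ s := by simp [s, SameCycle.refl]
    rw [hσ.zpow_apply_eq_zpow_apply hb, hτ.zpow_apply_eq_zpow_apply hb]
  let F : α → α := fun x => (τ ^ k x) (base x)
  have hF : ∀ x, SameCycle σ x (F x) := fun x =>
    SameCycle.trans (SameCycle.symm ⟨k x, hk x⟩) ((h _ _).2 ⟨k x, rfl⟩)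
  have hinj : Function.Injective F := by
    intro x y hxy
    have hb : base x = base y := hbase' x y ((hF x).trans (by rw [hxy]; exact (hF y).symm))
    have h1 : (τ ^ k x) (base x) = (τ ^ k y) (base x) := by
      change F x = _
      rw [hxy, hb]
    rw [← hcyc, hk, hb, hk] at h1
    exact h1
  refine ⟨Equiv.ofBijective F (Finite.injective_iff_bijective.1 hinj), hF, ?_⟩
  rw [mul_inv_eq_iff_eq_mul]
  ext x
  have hb : base (σ x) = base x := hbase' _ _ (sameCycle_apply_left.2 (SameCycle.refl _ _))
  have h1 : (σ ^ k (σ x)) (base x) = (σ ^ (k x + 1)) (base x) := by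
    rw [add_comm, zpow_add, zpow_one, mul_apply, hk x, ← hb, hk]
  rw [hcyc, add_comm, zpow_add, zpow_one, mul_apply] at h1
  change (τ ^ k (σ x)) (base (σ x)) = τ ((τ ^ k x) (base x))
  rw [hb, h1]

/-- Interpolation: an integer function of the permutations with given cycles (as sets) that varies
by at most one under conjugation by transpositions takes all intermediate values. -/
theorem exists_eq_of_conj_swap_le [Finite α] [DecidableEq α] {σ τ : Perm α}
    (h : ∀ x y, SameCycle σ x y ↔ SameCycle τ x y) (f : Perm α → ℤ)
    (hf : ∀ (ρ : Perm α) (a b : α), a ≠ b → f (swap a b * ρ * swap a b) ≤ f ρ + 1)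
    (m : ℤ) (h₁ : f σ ≤ m) (h₂ : m ≤ f τ) :
    ∃ ρ : Perm α, (∀ x y, SameCycle ρ x y ↔ SameCycle σ x y) ∧ f ρ = m := by
  have := Fintype.ofFinite α
  obtain ⟨π, hπ, rfl⟩ := exists_conj_of_sameCycle_iff h
  clear h
  have hconj : ∀ π : Perm α, (∀ x, SameCycle σ x (π x)) →
      ∀ x y, SameCycle (π * σ * π⁻¹) x y ↔ SameCycle σ x y := by
    intro π hπ x y
    rw [sameCycle_conj]
    have hx := hπ (π⁻¹ x)
    have hy := hπ (π⁻¹ y)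
    rw [show π (π⁻¹ x) = x from π.apply_symm_apply x] at hx
    rw [show π (π⁻¹ y) = y from π.apply_symm_apply y] at hy
    exact ⟨fun h => hx.symm.trans (h.trans hy), fun h => hx.trans (h.trans hy.symm)⟩
  induction hn : π.support.card using Nat.strong_induction_on generalizing π with
  | _ n ih =>
    by_cases h1 : π = 1
    · subst h1
      refine ⟨σ, fun _ _ => Iff.rfl, le_antisymm h₁ ?_⟩
      simpa using h₂
    obtain ⟨a, ha⟩ : ∃ a, π a ≠ a := by
      by_contra! hc
      exact h1 (Equiv.ext hc)
    have hcard := card_support_swap_mul ha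
    have hπ' : ∀ x, SameCycle σ x ((swap a (π a) * π) x) := by
      intro x
      by_cases hx1 : π x = a
      · rw [mul_apply, hx1, swap_apply_left]
        have := hπ x
        rw [hx1] at this
        exact this.trans (hπ a)
      by_cases hx2 : π x = π a
      · rw [mul_apply, hx2, swap_apply_right, π.injective hx2]
      · rw [swap_mul_apply_of_ne hx1 hx2]; exact hπ x
    -- The conjugator with smaller support differs from `π` by one transposition. If its value still
    -- reaches `m`, recurse. Otherwise the value goes from below `m` to at least `m` in one step of
    -- size at most one, and so equals `m`.
    by_cases hm : m ≤ f (swap a (π a) * π * σ * (swap a (π a) * π)⁻¹)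
    · exact ih _ (hn ▸ hcard) (swap a (π a) * π) hπ' hm rfl
    · refine ⟨π * σ * π⁻¹, hconj π hπ, le_antisymm ?_ h₂⟩
      have := hf (swap a (π a) * π * σ * (swap a (π a) * π)⁻¹) a (π a) (Ne.symm ha)
      have heq : swap a (π a) * (swap a (π a) * π * σ * (swap a (π a) * π)⁻¹) * swap a (π a) =
          π * σ * π⁻¹ := by
        rw [mul_inv_rev, swap_inv]
        simp only [mul_assoc, swap_mul_self_mul, swap_mul_self, mul_one]
      rw [heq] at this
      omega

/-! #### First-return permutations -/

/-- `N` is the first-return permutation of `M` on the range of `ι`, and at most one step is needed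
to return. -/
def IsReturn (M : Perm β) (ι : α → β) (N : Perm α) : Prop :=
  ∀ t, M (ι t) = ι (N t) ∨ (M (ι t) ∉ Set.range ι ∧ M (M (ι t)) = ι (N t))

theorem exists_isReturn [Finite α] {M : Perm β} {ι : α → β} (hι : Function.Injective ι)
    (h : ∀ t, M (ι t) ∈ Set.range ι ∨ M (M (ι t)) ∈ Set.range ι) : ∃ N, IsReturn M ι N := by
  have h' : ∀ t, ∃ s, M (ι t) = ι s ∨ (M (ι t) ∉ Set.range ι ∧ M (M (ι t)) = ι s) := by
    intro t
    by_cases ht : M (ι t) ∈ Set.range ι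
    · obtain ⟨s, hs⟩ := ht
      exact ⟨s, Or.inl hs.symm⟩
    · obtain ⟨s, hs⟩ := (h t).resolve_left ht
      exact ⟨s, Or.inr ⟨ht, hs.symm⟩⟩
  choose N hN using h'
  have hinj : Function.Injective N := by
    intro t s hts
    rcases hN t with h1 | ⟨h1, h1'⟩ <;> rcases hN s with h2 | ⟨h2, h2'⟩
    · exact hι (M.injective (by rw [h1, h2, hts]))
    · rw [← hts, ← h1] at h2'
      exact absurd ⟨t, (M.injective h2').symm⟩ h2
    · rw [hts, ← h2] at h1'
      exact absurd ⟨s, (M.injective h1').symm⟩ h1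
    · exact hι (M.injective (M.injective (by rw [h1', h2', hts])))
  exact ⟨Equiv.ofBijective N (Finite.injective_iff_bijective.1 hinj), hN⟩

theorem IsReturn.unique {M : Perm β} {ι : α → β} (hι : Function.Injective ι) {N N' : Perm α}
    (h : IsReturn M ι N) (h' : IsReturn M ι N') : N = N' := by
  ext t
  rcases h t with h1 | ⟨h1, h1'⟩ <;> rcases h' t with h2 | ⟨h2, h2'⟩
  · exact hι (by rw [← h1, ← h2])
  · exact absurd ⟨_, h1.symm⟩ h2
  · exact absurd ⟨_, h2.symm⟩ h1
  · exact hι (by rw [← h1', ← h2'])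

/-- A walk of `M` between two points of the range breaks up into steps of `N`, each using one or two
steps of `M`. This is why the induction on its length is strong. -/
theorem IsReturn.sameCycle_iff [Finite α] [Finite β] {M : Perm β} {ι : α → β}
    (hι : Function.Injective ι) {N : Perm α} (h : IsReturn M ι N) (s t : α) :
    SameCycle N s t ↔ SameCycle M (ι s) (ι t) := by
  constructor
  · intro hst
    refine SameCycle.rel_of_step (r := fun s t => SameCycle M (ι s) (ι t))
      (fun x => SameCycle.refl _ _) (fun x y hxy => hxy.trans ?_) hst
    rcases h y with h1 | ⟨-, h1⟩ <;> rw [← h1]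
    · exact sameCycle_apply_right.2 (SameCycle.refl _ _)
    · exact sameCycle_apply_right.2 (sameCycle_apply_right.2 (SameCycle.refl _ _))
  · intro hst
    obtain ⟨n, hn⟩ := hst.exists_nat_pow_eq
    clear hst
    induction n using Nat.strong_induction_on generalizing s with
    | _ n ih =>
      match n, hn with
      | 0, hn => exact (hι (show ι s = ι t by simpa using hn)) ▸ SameCycle.refl _ _
      | n + 1, hn =>
        rw [pow_succ, mul_apply] at hn
        rcases h s with h1 | ⟨h1, h2⟩
        · rw [h1] at hn
          exact sameCycle_apply_left.1 (ih n (by omega) _ hn)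
        · match n, hn with
          | 0, hn => exact absurd ⟨t, by simpa using hn.symm⟩ h1
          | n + 1, hn =>
            rw [pow_succ, mul_apply, h2] at hn
            exact sameCycle_apply_left.1 (ih n (by omega) _ hn)

/-- The hypothesis `hmeet` rules out cycles of `M` that avoid the range and would be lost. -/
theorem IsReturn.numCycles_eq [Finite α] [Finite β] {M : Perm β} {ι : α → β}
    (hι : Function.Injective ι) {N : Perm α} (h : IsReturn M ι N)
    (hmeet : ∀ x, x ∉ Set.range ι → M x ∈ Set.range ι) : numCycles N = numCycles M := by
  refine Nat.card_eq_of_bijective (Quotient.map' (s₁ := SameCycle.setoid N)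
    (s₂ := SameCycle.setoid M) ι fun s t => (h.sameCycle_iff hι s t).1) ⟨?_, ?_⟩
  · rintro ⟨s⟩ ⟨t⟩ hst
    exact Quotient.sound (s := SameCycle.setoid N)
      ((h.sameCycle_iff hι s t).2 (Quotient.exact (s := SameCycle.setoid M) hst))
  · rintro ⟨x⟩
    by_cases hx : x ∈ Set.range ι
    · obtain ⟨t, rfl⟩ := hx
      exact ⟨Quotient.mk (SameCycle.setoid N) t, rfl⟩
    · obtain ⟨t, ht⟩ := hmeet x hx
      refine ⟨Quotient.mk (SameCycle.setoid N) t,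
        Quotient.sound (s := SameCycle.setoid M) ?_⟩
      change SameCycle M (ι t) x
      rw [ht]
      exact sameCycle_apply_left.2 (SameCycle.refl _ _)

/-! #### Disjoint unions -/

theorem sumCongr_pow_apply_inl (σ : Perm α) (τ : Perm β) (n : ℤ) (x : α) :
    ((sumCongr σ τ) ^ n) (Sum.inl x) = Sum.inl ((σ ^ n) x) := by
  have h := map_zpow (sumCongrHom α β) (σ, τ) n
  change sumCongr ((σ, τ) ^ n).1 ((σ, τ) ^ n).2 = sumCongr σ τ ^ n at h
  rw [← h]; simp [sumCongr]

theorem sumCongr_pow_apply_inr (σ : Perm α) (τ : Perm β) (n : ℤ) (x : β) :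
    ((sumCongr σ τ) ^ n) (Sum.inr x) = Sum.inr ((τ ^ n) x) := by
  have h := map_zpow (sumCongrHom α β) (σ, τ) n
  change sumCongr ((σ, τ) ^ n).1 ((σ, τ) ^ n).2 = sumCongr σ τ ^ n at h
  rw [← h]; simp [sumCongr]

@[simp] theorem sameCycle_sumCongr_inl_inl (σ : Perm α) (τ : Perm β) (x y : α) :
    SameCycle (sumCongr σ τ) (Sum.inl x) (Sum.inl y) ↔ SameCycle σ x y := by
  simp [SameCycle, sumCongr_pow_apply_inl]

@[simp] theorem sameCycle_sumCongr_inr_inr (σ : Perm α) (τ : Perm β) (x y : β) :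
    SameCycle (sumCongr σ τ) (Sum.inr x) (Sum.inr y) ↔ SameCycle τ x y := by
  simp [SameCycle, sumCongr_pow_apply_inr]

@[simp] theorem not_sameCycle_sumCongr_inl_inr (σ : Perm α) (τ : Perm β) (x : α) (y : β) :
    ¬ SameCycle (sumCongr σ τ) (Sum.inl x) (Sum.inr y) := by
  simp [SameCycle, sumCongr_pow_apply_inl]

@[simp] theorem not_sameCycle_sumCongr_inr_inl (σ : Perm α) (τ : Perm β) (x : α) (y : β) :
    ¬ SameCycle (sumCongr σ τ) (Sum.inr y) (Sum.inl x) := by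
  simp [SameCycle, sumCongr_pow_apply_inr]

theorem numCycles_sumCongr [Finite α] [Finite β] (σ : Perm α) (τ : Perm β) :
    numCycles (sumCongr σ τ) = numCycles σ + numCycles τ := by
  unfold numCycles
  have : Finite (Quotient (SameCycle.setoid σ)) := inferInstance
  rw [← Nat.card_sum]
  refine (Nat.card_eq_of_bijective (Sum.elim
    (Quotient.map' (s₁ := SameCycle.setoid σ) (s₂ := SameCycle.setoid (sumCongr σ τ)) Sum.inl
      fun x y h => (sameCycle_sumCongr_inl_inl σ τ x y).2 h)
    (Quotient.map' (s₁ := SameCycle.setoid τ) (s₂ := SameCycle.setoid (sumCongr σ τ)) Sum.inr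
      fun x y h => (sameCycle_sumCongr_inr_inr σ τ x y).2 h)) ⟨?_, ?_⟩).symm
  · rintro (⟨⟨x⟩⟩ | ⟨⟨x⟩⟩) (⟨⟨y⟩⟩ | ⟨⟨y⟩⟩) h
    · exact congrArg Sum.inl (Quotient.sound (s := SameCycle.setoid σ)
        ((sameCycle_sumCongr_inl_inl σ τ x y).1
          (Quotient.exact (s := SameCycle.setoid (sumCongr σ τ)) h)))
    · exact absurd (Quotient.exact (s := SameCycle.setoid (sumCongr σ τ)) h)
        (not_sameCycle_sumCongr_inl_inr σ τ x y)
    · exact absurd (Quotient.exact (s := SameCycle.setoid (sumCongr σ τ)) h)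
        (not_sameCycle_sumCongr_inr_inl σ τ y x)
    · exact congrArg Sum.inr (Quotient.sound (s := SameCycle.setoid τ)
        ((sameCycle_sumCongr_inr_inr σ τ x y).1
          (Quotient.exact (s := SameCycle.setoid (sumCongr σ τ)) h)))
  · rintro ⟨x | y⟩
    · exact ⟨Sum.inl (Quotient.mk (SameCycle.setoid σ) x), rfl⟩
    · exact ⟨Sum.inr (Quotient.mk (SameCycle.setoid τ) y), rfl⟩

/-! ### Splicing two permutations at two pairs of points. -/

variable [DecidableEq α] [DecidableEq β]

/-- The permutation of a disjoint union that inserts the cycles of two points `p`, `q` into the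
cycles of `g`, `g'`. -/
def splice (p q : α) (g g' : β) (σ : Perm α) (τ : Perm β) : Perm (α ⊕ β) :=
  swap (Sum.inl p) (Sum.inr g) * (swap (Sum.inl q) (Sum.inr g') * sumCongr σ τ)

section Splice

variable [Finite α] [Finite β] {σ : Perm α} {τ : Perm β} {p q : α} {g g' : β}

/-- The first transposition attaches only the cycle of `q` to the right summand. The cycle of `p` is
still wholly on the left, so the second one merges as well, even if `g` and `g'` share a cycle. -/
theorem not_sameCycle_splice_aux (hpq : ¬ SameCycle σ p q) :
    ¬ SameCycle (swap (Sum.inl q) (Sum.inr g') * sumCongr σ τ) (Sum.inl p) (Sum.inr g) := by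
  rw [sameCycle_swap_mul_iff (not_sameCycle_sumCongr_inl_inr _ _ _ _)]
  simp [hpq]

theorem numCycles_splice (hpq : ¬ SameCycle σ p q) :
    numCycles (splice p q g g' σ τ) + 2 = numCycles σ + numCycles τ := by
  have h1 := numCycles_swap_mul_of_not_sameCycle
    (not_sameCycle_splice_aux (τ := τ) (g := g) (g' := g') hpq)
  have h2 := numCycles_swap_mul_of_not_sameCycle (not_sameCycle_sumCongr_inl_inr σ τ q g')
  rw [numCycles_sumCongr] at h2
  unfold splice
  omega

/-- Each of the two attached cycles of `σ` is joined to a single cycle of `τ`, so none of them can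
link two cycles of `τ`. -/
theorem sameCycle_splice_inr_inr (hpq : ¬ SameCycle σ p q) (x y : β) :
    SameCycle (splice p q g g' σ τ) (Sum.inr x) (Sum.inr y) ↔ SameCycle τ x y := by
  unfold splice
  rw [sameCycle_swap_mul_iff (not_sameCycle_splice_aux hpq)]
  simp only [sameCycle_swap_mul_iff (not_sameCycle_sumCongr_inl_inr σ τ q g'),
    sameCycle_sumCongr_inl_inl, sameCycle_sumCongr_inr_inr, not_sameCycle_sumCongr_inl_inr,
    not_sameCycle_sumCongr_inr_inl, hpq]
  simp only [false_or, and_false, or_false]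
  constructor
  · rintro ((h | ⟨h, h'⟩) | ⟨h | ⟨h, h'⟩, h₂ | ⟨h₂, h₂'⟩⟩)
    · exact h
    · exact h.trans h'.symm
    · exact h.trans h₂.symm
    · exact h.trans (h₂'.trans h₂.symm)
    · exact h.trans (h'.symm.trans h₂.symm)
    · exact h.trans h₂.symm
  · exact fun h => Or.inl (Or.inl h)

theorem sameCycle_splice_inl_inl (hpq : ¬ SameCycle σ p q) {x y : α} (h : SameCycle σ x y) :
    SameCycle (splice p q g g' σ τ) (Sum.inl x) (Sum.inl y) :=
  (sameCycle_swap_mul_iff (not_sameCycle_splice_aux hpq) _ _).2 (Or.inl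
    ((sameCycle_swap_mul_iff (not_sameCycle_sumCongr_inl_inr _ _ _ _) _ _).2 (Or.inl
      ((sameCycle_sumCongr_inl_inl _ _ _ _).2 h))))

theorem sameCycle_splice_left (hpq : ¬ SameCycle σ p q) :
    SameCycle (splice p q g g' σ τ) (Sum.inl p) (Sum.inr g) :=
  (sameCycle_swap_mul_iff (not_sameCycle_splice_aux hpq) _ _).2 (Or.inr
    ⟨Or.inl (SameCycle.refl _ _), Or.inr (SameCycle.refl _ _)⟩)

theorem sameCycle_splice_right (hpq : ¬ SameCycle σ p q) :
    SameCycle (splice p q g g' σ τ) (Sum.inl q) (Sum.inr g') :=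
  (sameCycle_swap_mul_iff (not_sameCycle_splice_aux hpq) _ _).2 (Or.inl
    ((sameCycle_swap_mul_iff (not_sameCycle_sumCongr_inl_inr _ _ _ _) _ _).2 (Or.inr
      ⟨Or.inl (SameCycle.refl _ _), Or.inr (SameCycle.refl _ _)⟩)))

end Splice

section SpliceApply

variable {p q : α} {g g' : β} (hpq : p ≠ q) (hg : g ≠ g') (σ : Perm α) (τ : Perm β)

include hpq hg

theorem splice_inl (x : α) : splice p q g g' σ τ (Sum.inl x) =
    if σ x = p then Sum.inr g else if σ x = q then Sum.inr g' else Sum.inl (σ x) := by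
  simp only [splice, mul_apply, sumCongr_apply, Sum.map_inl]
  split_ifs with h1 h2
  · rw [h1, swap_apply_of_ne_of_ne (a := Sum.inl q) (by simpa using hpq) (by simp),
      swap_apply_left]
  · rw [h2, swap_apply_left, swap_apply_of_ne_of_ne (by simp) (by simpa using hg.symm)]
  · rw [swap_apply_of_ne_of_ne (a := Sum.inl q) (by simpa using h2) (by simp),
      swap_apply_of_ne_of_ne (by simpa using h1) (by simp)]

theorem splice_inr (y : β) : splice p q g g' σ τ (Sum.inr y) =
    if τ y = g then Sum.inl p else if τ y = g' then Sum.inl q else Sum.inr (τ y) := by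
  simp only [splice, mul_apply, sumCongr_apply, Sum.map_inr]
  split_ifs with h1 h2
  · rw [h1, swap_apply_of_ne_of_ne (a := Sum.inl q) (by simp) (by simpa using hg),
      swap_apply_right]
  · rw [h2, swap_apply_right, swap_apply_of_ne_of_ne (by simpa using hpq.symm) (by simp)]
  · rw [swap_apply_of_ne_of_ne (a := Sum.inl q) (by simp) (by simpa using h2),
      swap_apply_of_ne_of_ne (by simp) (by simpa using h1)]

/-- Interchanging the exits `p`, `q` on the left can be traded for a transposition of `g`, `g'` on
the right, up to renaming these two points. This reduces the case of `p`, `q` in one cycle to that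
of different cycles, and it turns the face tracing of `H` into its `twist`. -/
theorem splice_swap_mul : splice p q g g' (swap p q * σ) τ =
    swap (Sum.inr g) (Sum.inr g') * splice p q g g' σ (τ * swap g g') *
      (swap (Sum.inr g) (Sum.inr g'))⁻¹ := by
  have hinl : ∀ x : α, swap (Sum.inr g) (Sum.inr g') (Sum.inl x : α ⊕ β) = Sum.inl x :=
    fun x => swap_apply_of_ne_of_ne (by simp) (by simp)
  have hinr : ∀ y : β, swap (Sum.inr g) (Sum.inr g') (Sum.inr y : α ⊕ β) =
      Sum.inr (swap g g' y) := by
    intro y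
    by_cases h1 : y = g
    · rw [h1, swap_apply_left, swap_apply_left]
    by_cases h2 : y = g'
    · rw [h2, swap_apply_right, swap_apply_right]
    rw [swap_apply_of_ne_of_ne (by simpa using h1) (by simpa using h2),
      swap_apply_of_ne_of_ne h1 h2]
  rw [swap_inv]
  ext1 (x | y)
  · rw [mul_apply, mul_apply, hinl, splice_inl hpq hg, splice_inl hpq hg, mul_apply]
    by_cases h1 : σ x = p
    · rw [h1, swap_apply_left, if_neg hpq.symm, if_pos rfl, if_pos rfl, swap_apply_left]
    by_cases h2 : σ x = q
    · rw [h2, swap_apply_right, if_pos rfl, if_neg hpq.symm, if_pos rfl, swap_apply_right]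
    rw [swap_apply_of_ne_of_ne h1 h2, if_neg h1, if_neg h2, hinl]
  · rw [mul_apply, mul_apply, hinr, splice_inr hpq hg, splice_inr hpq hg, mul_apply,
      swap_apply_self]
    split_ifs with h1 h2
    · rw [hinl]
    · rw [hinl]
    · rw [hinr, swap_apply_of_ne_of_ne h1 h2]

end SpliceApply

theorem splice_mul_sumCongr (p q : α) (g g' : β) (σ σ' : Perm α) (τ τ' : Perm β) :
    splice p q g g' σ τ * sumCongr σ' τ' = splice p q g g' (σ * σ') (τ * τ') := by
  simp only [splice, mul_assoc, sumCongr_mul]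

end Equiv.Perm

/-! ### Genera of embeddings -/

open scoped Classical in
theorem Set.ncard_inter_pair_of_ne {α : Type*} (A : Set α) {y z : α} (h : y ≠ z) :
    (A ∩ {y, z}).ncard = (if y ∈ A then 1 else 0) + (if z ∈ A then 1 else 0) := by
  by_cases hy : y ∈ A <;> by_cases hz : z ∈ A
  · rw [Set.inter_eq_self_of_subset_right (by rintro x (rfl | rfl) <;> assumption),
      Set.ncard_pair h]
    simp [hy, hz]
  · have : A ∩ {y, z} = {y} := by
      ext x; constructor
      · rintro ⟨hx, rfl | rfl⟩
        · rfl
        · exact absurd hx hz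
      · rintro rfl; exact ⟨hy, Or.inl rfl⟩
    simp [this, hy, hz]
  · have : A ∩ {y, z} = {z} := by
      ext x; constructor
      · rintro ⟨hx, rfl | rfl⟩
        · exact absurd hx hy
        · rfl
      · rintro rfl; exact ⟨hz, Or.inr rfl⟩
    simp [this, hy, hz]
  · have : A ∩ {y, z} = ∅ := by
      ext x; constructor
      · rintro ⟨hx, rfl | rfl⟩
        · exact absurd hx hy
        · exact absurd hx hz
      · exact False.elim
    simp [this, hy, hz]

open scoped Classical in
theorem Set.ncard_inter_pair_self {α : Type*} (A : Set α) (y : α) :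
    (A ∩ {y, y}).ncard = if y ∈ A then 1 else 0 := by
  by_cases hy : y ∈ A
  · rw [Set.pair_eq_singleton, Set.inter_eq_self_of_subset_right (Set.singleton_subset_iff.2 hy)]; simp [hy]
  · have : A ∩ {y, y} = ∅ := by
      ext x; constructor
      · rintro ⟨hx, rfl | rfl⟩ <;> exact absurd hx hy
      · exact False.elim
    rw [this, Set.ncard_empty, if_neg hy]

namespace MultiGraph

open Equiv Equiv.Perm

open scoped Classical

instance (G : MultiGraph) : Finite G.V := G.finV

instance (G : MultiGraph) : Finite G.Dart := G.finDart

variable {G : MultiGraph}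

theorem surjective_src_of_isRootEdge {e : G.Dart} (he : G.IsRootEdge e) :
    Function.Surjective G.src := by
  intro v
  obtain ⟨w, hw⟩ : ∃ w, v ≠ w := by
    by_cases h : v = G.src e
    · exact ⟨G.src (G.rev e), h ▸ he.1⟩
    · exact ⟨_, h⟩
  rcases Relation.ReflTransGen.cases_head (G.connected v w) with h | ⟨_, ⟨d, hd, -⟩, -⟩
  · exact absurd h hw
  · exact ⟨d, hd⟩

/-- Reversal cycles are the edges. In particular the number of darts is even, so halving it in
Euler's formula loses nothing. -/
theorem two_mul_numCycles_revPerm : 2 * numCycles G.revPerm = Nat.card G.Dart := by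
  have hrel : ∀ x y, SameCycle G.revPerm x y ↔ y = x ∨ y = G.rev x := by
    intro x y
    constructor
    · intro h
      refine SameCycle.rel_of_step (r := fun x y => y = x ∨ y = G.rev x)
        (fun _ => Or.inl rfl) ?_ h
      rintro x y (rfl | rfl)
      · exact Or.inr rfl
      · exact Or.inl (G.rev_rev _)
    · rintro (rfl | rfl)
      · exact SameCycle.refl _ _
      · exact ⟨1, rfl⟩
  have := Fintype.ofFinite G.Dart
  let Q := Quotient (SameCycle.setoid G.revPerm)
  have : Finite Q := inferInstanceAs (Finite (Quotient _))
  have := Fintype.ofFinite Q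
  have h := Finset.card_eq_sum_card_fiberwise (s := (Finset.univ : Finset G.Dart))
    (t := (Finset.univ : Finset Q)) (f := Quotient.mk (SameCycle.setoid G.revPerm))
    (fun _ _ => Finset.mem_coe.2 (Finset.mem_univ _))
  have hfib : ∀ q : Q, (Finset.univ.filter
      fun d => Quotient.mk (SameCycle.setoid G.revPerm) d = q).card = 2 := by
    intro q
    obtain ⟨x, rfl⟩ := Quotient.exists_rep q
    have : (Finset.univ.filter fun d => Quotient.mk (SameCycle.setoid G.revPerm) d =
        Quotient.mk (SameCycle.setoid G.revPerm) x) = {x, G.rev x} := by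
      ext d
      rw [Finset.mem_filter, Finset.mem_insert, Finset.mem_singleton, ← hrel]
      constructor
      · exact fun h => (Quotient.exact (s := SameCycle.setoid G.revPerm) h.2).symm
      · exact fun h => ⟨Finset.mem_univ _,
          Quotient.sound (s := SameCycle.setoid G.revPerm) h.symm⟩
    rw [this, Finset.card_pair (G.rev_ne x).symm]
  rw [Finset.sum_congr rfl fun q _ => hfib q] at h
  rw [Nat.card_eq_fintype_card, ← Finset.card_univ, h, Finset.sum_const, Finset.card_univ,
    ← Nat.card_eq_fintype_card, smul_eq_mul, mul_comm]
  rfl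

namespace Embedding

theorem rot_injective : Function.Injective (Embedding.rot (G := G)) := by
  rintro ⟨r, h⟩ ⟨r', h'⟩ rfl
  rfl

instance : Finite (Embedding G) := Finite.of_injective _ rot_injective

noncomputable instance : Fintype (Embedding G) := Fintype.ofFinite _

variable (ρ : Embedding G)

theorem face_eq_iff (d d' : G.Dart) : ρ.face d = ρ.face d' ↔ SameCycle ρ.next d d' :=
  Quotient.eq (r := SameCycle.setoid ρ.next)

theorem card_face : Nat.card ρ.Face = numCycles ρ.next := rfl

theorem src_rot (d : G.Dart) : G.src (ρ.rot d) = G.src d :=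
  ((ρ.sameCycle_iff _ _).1 (sameCycle_apply_right.2 (SameCycle.refl _ _))).symm

theorem numCycles_rot (hG : Function.Surjective G.src) : numCycles ρ.rot = Nat.card G.V := by
  refine Nat.card_eq_of_bijective (Quotient.lift (s := SameCycle.setoid ρ.rot) G.src
    fun a b h => (ρ.sameCycle_iff a b).1 h) ⟨?_, ?_⟩
  · rintro ⟨a⟩ ⟨b⟩ h
    exact Quotient.sound (s := SameCycle.setoid ρ.rot) ((ρ.sameCycle_iff a b).2 h)
  · intro v
    obtain ⟨d, rfl⟩ := hG v
    exact ⟨Quotient.mk (SameCycle.setoid ρ.rot) d, rfl⟩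

/-- The parity of the Euler characteristic. -/
theorem two_dvd_euler (hG : Function.Surjective G.src) :
    (2 : ℤ) ∣ 2 - Nat.card G.V + (Nat.card G.Dart / 2 : ℕ) - numCycles ρ.next := by
  have := Fintype.ofFinite G.Dart
  -- Expressed by numbers of cycles, the signs give F ≡ V + E modulo 2, the number of darts being
  -- even.
  have h : sign ρ.next = sign ρ.rot * sign G.revPerm := sign_mul _ _
  simp only [sign_eq_neg_one_pow_card_add_numCycles, ← pow_add] at h
  rw [ρ.numCycles_rot hG, ← Nat.card_eq_fintype_card] at h
  have h2 := G.two_mul_numCycles_revPerm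
  rw [← h2] at h ⊢
  rw [Nat.mul_div_cancel_left _ (by norm_num)]
  have h3 : ∀ m n : ℕ, ((-1 : ℤˣ) ^ m = (-1) ^ n) → m % 2 = n % 2 := by
    intro m n h
    rcases Nat.even_or_odd m with hm | hm <;> rcases Nat.even_or_odd n with hn | hn
    · rw [Nat.even_iff.1 hm, Nat.even_iff.1 hn]
    · rw [hm.neg_one_pow, hn.neg_one_pow] at h; exact absurd h (by decide)
    · rw [hm.neg_one_pow, hn.neg_one_pow] at h; exact absurd h (by decide)
    · rw [Nat.odd_iff.1 hm, Nat.odd_iff.1 hn]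
  have := h3 _ _ h
  omega

/-- The genus of the surface of an embedding. -/
noncomputable def genus : ℤ :=
  (2 - Nat.card G.V + (Nat.card G.Dart / 2 : ℕ) - numCycles ρ.next) / 2

theorem hasGenus_iff (hG : Function.Surjective G.src) (i : ℤ) : ρ.HasGenus i ↔ ρ.genus = i := by
  have h := ρ.two_dvd_euler hG
  unfold HasGenus genus
  rw [card_face]
  omega

/-- The face-tracing permutation after the removal of the edge `g`; the two darts of `g` are kept
on the boundary walks. -/
noncomputable def twist (g : G.Dart) : Perm G.Dart := ρ.next * swap g (G.rev g)

/-- One more than the genus of the embedding that results from the removal of the edge `g` (the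
total genus, if the removal disconnects the graph). -/
noncomputable def twistGenus (g : G.Dart) : ℤ :=
  (3 - Nat.card G.V + (Nat.card G.Dart / 2 : ℕ) - numCycles (ρ.twist g)) / 2

theorem twist_eq (g : G.Dart) :
    ρ.twist g = swap (ρ.next g) (ρ.next (G.rev g)) * ρ.next := mul_swap_eq_swap_mul _ _ _

/-- The two faces at `g` merge: one cycle is lost, and together with the constant 3 in place of 2
the numerator grows by two. -/
theorem twistGenus_of_typeD {g : G.Dart} (h : ρ.TypeD g) : ρ.twistGenus g = ρ.genus + 1 := by
  rw [TypeD, Ne, face_eq_iff] at h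
  have := numCycles_swap_mul_of_not_sameCycle (σ := ρ.next) (a := ρ.next g)
    (b := ρ.next (G.rev g)) (by rwa [sameCycle_apply_left, sameCycle_apply_right])
  unfold twistGenus genus
  rw [twist_eq]
  omega

/-- The face at `g` splits, and the additional cycle cancels the additional 1 in the constant. -/
theorem twistGenus_of_typeS {g : G.Dart} (h : ρ.TypeS g) : ρ.twistGenus g = ρ.genus := by
  rw [TypeS, face_eq_iff] at h
  have := numCycles_swap_mul_of_sameCycle (σ := ρ.next) (a := ρ.next g)
    (b := ρ.next (G.rev g)) (fun h => G.rev_ne g (ρ.next.injective h).symm)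
    (by rwa [sameCycle_apply_left, sameCycle_apply_right])
  unfold twistGenus genus
  rw [twist_eq]
  omega

/-- Multiplying by the transposition on the right or on the left gives conjugate permutations, and
the conjugation moves only the two darts of `g`. -/
theorem sameCycle_twist_iff {g a b : G.Dart} (ha : a ≠ g) (ha' : a ≠ G.rev g) (hb : b ≠ g)
    (hb' : b ≠ G.rev g) :
    SameCycle (ρ.twist g) a b ↔ SameCycle (swap g (G.rev g) * ρ.next) a b := by
  have h : ρ.twist g = swap g (G.rev g) * (swap g (G.rev g) * ρ.next) * (swap g (G.rev g))⁻¹ := by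
    rw [twist, swap_mul_self_mul, swap_inv]
  rw [h, sameCycle_conj, swap_inv, swap_apply_of_ne_of_ne ha ha', swap_apply_of_ne_of_ne hb hb']

/-- The surfaces of the embeddings obtained by a change of the rotation system. -/
theorem exists_div_eq (π : Perm G.Dart) (C : ℤ) (ρ₁ ρ₂ : Embedding G) (m : ℤ)
    (h₁ : (C - numCycles (ρ₁.rot * π)) / 2 ≤ m) (h₂ : m ≤ (C - numCycles (ρ₂.rot * π)) / 2) :
    ∃ ρ : Embedding G, (C - numCycles (ρ.rot * π)) / 2 = m := by
  obtain ⟨r, hr, hm⟩ := exists_eq_of_conj_swap_le (σ := ρ₁.rot) (τ := ρ₂.rot)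
    (fun x y => by rw [ρ₁.sameCycle_iff, ρ₂.sameCycle_iff])
    (fun r => (C - numCycles (r * π)) / 2) (fun r a b hab => by
      -- Conjugating the rotation multiplies `r * π` by two transpositions. The number of cycles
      -- changes by -2, 0 or 2, hence the floor of the half by at most one.
      have h : swap a b * r * swap a b * π =
          swap a b * (swap (r a) (r b) * (r * π)) := by
        rw [mul_assoc (swap a b), mul_swap_eq_swap_mul]
        simp only [mul_assoc]
      have h1 := numCycles_swap_mul (swap (r a) (r b) * (r * π)) hab
      have h2 := numCycles_swap_mul (r * π) (fun h => hab (r.injective h))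
      rw [h]
      omega) m h₁ h₂
  exact ⟨⟨r, fun d d' => by rw [hr, ρ₁.sameCycle_iff]⟩, hm⟩

theorem exists_genus_eq (ρ₁ ρ₂ : Embedding G) (m : ℤ) (h₁ : ρ₁.genus ≤ m) (h₂ : m ≤ ρ₂.genus) :
    ∃ ρ : Embedding G, ρ.genus = m :=
  exists_div_eq _ _ ρ₁ ρ₂ m h₁ h₂

theorem exists_twistGenus_eq (g : G.Dart) (ρ₁ ρ₂ : Embedding G) (m : ℤ)
    (h₁ : ρ₁.twistGenus g ≤ m) (h₂ : m ≤ ρ₂.twistGenus g) :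
    ∃ ρ : Embedding G, ρ.twistGenus g = m := by
  unfold twistGenus twist next at *
  simp only [mul_assoc] at *
  exact exists_div_eq _ _ ρ₁ ρ₂ m h₁ h₂

theorem twistGenus_eq_or (g : G.Dart) :
    ρ.twistGenus g = ρ.genus ∨ ρ.twistGenus g = ρ.genus + 1 := by
  by_cases h : ρ.TypeS g
  · exact Or.inl (ρ.twistGenus_of_typeS h)
  · exact Or.inr (ρ.twistGenus_of_typeD h)

/-! #### The effect of the removal of one edge on the type of another edge -/

section Twist

variable {g f : G.Dart}

theorem shared_of_typeD (hf : ρ.TypeD f) : ρ.shared g f =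
    (if SameCycle ρ.next f g ∨ SameCycle ρ.next f (G.rev g) then 1 else 0) +
      (if SameCycle ρ.next (G.rev f) g ∨ SameCycle ρ.next (G.rev f) (G.rev g)
        then 1 else 0) := by
  rw [shared, Set.ncard_inter_pair_of_ne _ hf]
  simp only [Set.mem_insert_iff, Set.mem_singleton_iff, face_eq_iff]

theorem shared_of_typeS (hf : ρ.TypeS f) : ρ.shared g f =
    if SameCycle ρ.next f g ∨ SameCycle ρ.next f (G.rev g) then 1 else 0 := by
  rw [TypeS] at hf
  rw [shared, ← hf, Set.ncard_inter_pair_self]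
  simp only [Set.mem_insert_iff, Set.mem_singleton_iff, face_eq_iff]

variable (h₁ : f ≠ g) (h₂ : f ≠ G.rev g) (h₃ : G.rev f ≠ g) (h₄ : G.rev f ≠ G.rev g)

include h₁ h₂ h₃ h₄

/-- Removing `g` merges its two faces; this joins the two sides of `f` only if these are the two
faces at `f`. -/
theorem sameCycle_twist_of_typeD_typeD (hg : ρ.TypeD g) (hf : ρ.TypeD f) :
    SameCycle (ρ.twist g) f (G.rev f) ↔ ρ.shared g f = 2 := by
  rw [ρ.sameCycle_twist_iff h₁ h₂ h₃ h₄, ρ.shared_of_typeD hf]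
  rw [TypeD, Ne, face_eq_iff] at hg hf
  rw [sameCycle_swap_mul_iff hg]
  simp only [hf, false_or]
  split_ifs <;> simp_all

theorem sameCycle_twist_of_typeD_typeS (hg : ρ.TypeD g) (hf : ρ.TypeS f) :
    SameCycle (ρ.twist g) f (G.rev f) := by
  rw [ρ.sameCycle_twist_iff h₁ h₂ h₃ h₄]
  rw [TypeD, Ne, face_eq_iff] at hg
  rw [TypeS, face_eq_iff] at hf
  rw [sameCycle_swap_mul_iff hg]
  exact Or.inl hf

theorem not_sameCycle_twist_of_typeS_typeD (hg : ρ.TypeS g) (hf : ρ.TypeD f) :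
    ¬ SameCycle (ρ.twist g) f (G.rev f) := by
  rw [ρ.sameCycle_twist_iff h₁ h₂ h₃ h₄]
  rw [TypeD, Ne, face_eq_iff] at hf
  rw [TypeS, face_eq_iff] at hg
  exact fun h => hf ((sameCycle_of_swap_mul_split (G.rev_ne g).symm hg _ _).2 (Or.inl h))

/-- The face at `g` is cut into two pieces. The sides of `f` land in different pieces when they
alternate with those of `g`; a face through `f` that avoids `g` is untouched. -/
theorem sameCycle_twist_of_typeS_typeS (hg : ρ.TypeS g) (hf : ρ.TypeS f) :
    SameCycle (ρ.twist g) f (G.rev f) ↔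
      ¬ (ρ.shared g f = 1 ∧ ρ.Alternating g f) := by
  rw [ρ.sameCycle_twist_iff h₁ h₂ h₃ h₄, ρ.shared_of_typeS hf]
  rw [TypeS, face_eq_iff] at hf hg
  have hne := (G.rev_ne g).symm
  have hsplit := sameCycle_of_swap_mul_split hne hg
  have hnot := not_sameCycle_swap_mul hne hg
  -- `Between` describes membership in the piece containing `g`, so alternation means that this
  -- piece contains exactly one side of `f`.
  have halt : ρ.Alternating g f ↔ Xor (SameCycle (swap g (G.rev g) * ρ.next) g f)
      (SameCycle (swap g (G.rev g) * ρ.next) g (G.rev f)) := by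
    rw [sameCycle_swap_mul_iff_between hne hg, sameCycle_swap_mul_iff_between hne hg]
    rfl
  have hmem : ∀ x, SameCycle ρ.next x g →
      SameCycle (swap g (G.rev g) * ρ.next) x g ∨
        SameCycle (swap g (G.rev g) * ρ.next) x (G.rev g) := by
    intro x hx
    rcases (hsplit x g).1 hx with h | h
    · exact Or.inl h
    · exact h.1
  rw [halt]
  by_cases hs : SameCycle ρ.next f g
  · rw [if_pos (Or.inl hs)]
    have hs' : SameCycle ρ.next (G.rev f) g := hf.symm.trans hs
    rw [sameCycle_comm (x := g), sameCycle_comm (x := g)]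
    rcases hmem f hs with h | h <;> rcases hmem _ hs' with h' | h'
    · simp [h, h', h.trans h'.symm]
    · have h5 : ¬ SameCycle (swap g (G.rev g) * ρ.next) (G.rev f) g :=
        fun h6 => hnot (h6.symm.trans h')
      have h6 : ¬ SameCycle (swap g (G.rev g) * ρ.next) f (G.rev f) :=
        fun h6 => hnot (h.symm.trans (h6.trans h'))
      simp [h, h5, h6]
    · have h5 : ¬ SameCycle (swap g (G.rev g) * ρ.next) f g :=
        fun h6 => hnot (h6.symm.trans h)
      have h6 : ¬ SameCycle (swap g (G.rev g) * ρ.next) f (G.rev f) :=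
        fun h6 => hnot (h'.symm.trans (h6.symm.trans h))
      simp [h', h5, h6]
    · have h5 : ¬ SameCycle (swap g (G.rev g) * ρ.next) f g :=
        fun h6 => hnot (h6.symm.trans h)
      have h6 : ¬ SameCycle (swap g (G.rev g) * ρ.next) (G.rev f) g :=
        fun h6 => hnot (h6.symm.trans h')
      simp [h5, h6, h.trans h'.symm]
  · have hs' : ¬ SameCycle ρ.next f (G.rev g) := fun h => hs (h.trans hg.symm)
    rw [if_neg (by tauto)]
    simp only [zero_ne_one, false_and, not_false_eq_true, iff_true]
    rcases (hsplit f (G.rev f)).1 hf with h | ⟨h | h, -⟩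
    · exact h
    · exact absurd ((hsplit f g).2 (Or.inl h)) hs
    · exact absurd ((hsplit f _).2 (Or.inl h)) hs'

end Twist

end Embedding

theorem count_eq_sum (hG : Function.Surjective G.src) (P : Embedding G → Prop) (i : ℤ) :
    G.count P i = ∑ ρ : Embedding G, if ρ.genus = i ∧ P ρ then 1 else 0 := by
  rw [count, Nat.card_eq_fintype_card, Fintype.card_subtype, Finset.card_filter]
  exact Finset.sum_congr rfl fun ρ _ => by simp only [ρ.hasGenus_iff hG]

end MultiGraph

/-! ### The four combinations of the hypothesis as counts by genus and by twisted genus. -/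

namespace DoublyEdgeRooted

open Equiv Equiv.Perm MultiGraph

open scoped Classical

variable (H : DoublyEdgeRooted)

theorem f_ne_g : H.f ≠ H.g := fun h => H.disjoint.1 (by rw [h])

theorem f_ne_rev_g : H.f ≠ H.rev H.g := fun h => H.disjoint.2.2.1 (by rw [h])

theorem rev_f_ne_g : H.rev H.f ≠ H.g := fun h => H.disjoint.2.1 (by rw [h])

theorem rev_f_ne_rev_g : H.rev H.f ≠ H.rev H.g := fun h => H.disjoint.2.2.2 (by rw [h])

/-- The numbers of embeddings by genus, with the two darts of `f` on one face-boundary walk if and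
only if `b` holds. -/
noncomputable def straightCount (b : Prop) (i : ℤ) : ℕ :=
  ∑ ρ : Embedding H.toMultiGraph,
    if ρ.genus = i ∧ (SameCycle ρ.next H.f (H.rev H.f) ↔ b) then 1 else 0

/-- The numbers of embeddings by twisted genus, with the two darts of `f` on one face-boundary walk
after the removal of `g` if and only if `b` holds. -/
noncomputable def twistCount (b : Prop) (i : ℤ) : ℕ :=
  ∑ ρ : Embedding H.toMultiGraph,
    if ρ.twistGenus H.g = i ∧ (SameCycle (ρ.twist H.g) H.f (H.rev H.f) ↔ b) then 1 else 0

theorem shared_cases_of_typeD {ρ : Embedding H.toMultiGraph} (hf : ρ.TypeD H.f) :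
    ρ.shared H.g H.f = 0 ∨ ρ.shared H.g H.f = 1 ∨ ρ.shared H.g H.f = 2 := by
  rw [ρ.shared_of_typeD hf]
  split_ifs <;> simp

theorem shared_cases_of_typeS {ρ : Embedding H.toMultiGraph} (hf : ρ.TypeS H.f) :
    ρ.shared H.g H.f = 0 ∨ ρ.shared H.g H.f = 1 := by
  rw [ρ.shared_of_typeS hf]
  split_ifs <;> simp

theorem shared_ne_two {ρ : Embedding H.toMultiGraph} (hg : ρ.TypeS H.g) (hf : ρ.TypeD H.f) :
    ρ.shared H.g H.f ≠ 2 := by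
  intro h
  rw [ρ.shared_of_typeD hf] at h
  rw [Embedding.TypeD, Ne, Embedding.face_eq_iff] at hf
  rw [Embedding.TypeS, Embedding.face_eq_iff] at hg
  split_ifs at h with h1 h2 <;> try omega
  have h3 : SameCycle ρ.next H.f H.g := h1.elim id fun h => h.trans hg.symm
  have h4 : SameCycle ρ.next (H.rev H.f) H.g := h2.elim id fun h => h.trans hg.symm
  exact hf (h3.trans h4.symm)

/-- The identity holds embedding by embedding. The offsets appear at type D of `g`, where the
twisted genus exceeds the genus by one, and the classes present are those that leave `f` on two
faces once `g` is removed. -/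
theorem A1_eq : H.A1 = H.twistCount False := by
  have hG := surjective_src_of_isRootEdge H.isRoot_g
  funext i
  simp only [A1, SD, DD0, DD1, SS2, SD0, SD1, offset, Pi.add_apply, count_eq_sum hG,
    ← Finset.sum_add_distrib, twistCount]
  refine Finset.sum_congr rfl fun ρ _ => ?_
  by_cases hg : ρ.TypeS H.g <;> by_cases hf : ρ.TypeS H.f
  · have hg' : ¬ ρ.TypeD H.g := not_not_intro hg
    have hf' : ¬ ρ.TypeD H.f := not_not_intro hf
    have := ρ.sameCycle_twist_of_typeS_typeS H.f_ne_g H.f_ne_rev_g H.rev_f_ne_g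
      H.rev_f_ne_rev_g hg hf
    simp [hg, hf, hg', hf', this, ρ.twistGenus_of_typeS hg]
  · have hg' : ¬ ρ.TypeD H.g := not_not_intro hg
    have := ρ.not_sameCycle_twist_of_typeS_typeD H.f_ne_g H.f_ne_rev_g H.rev_f_ne_g
      H.rev_f_ne_rev_g hg hf
    have hf' : ρ.TypeD H.f := hf
    have h2 := H.shared_ne_two hg hf
    rcases H.shared_cases_of_typeD hf' with h | h | h
    · simp [hg, hf, hg', hf', this, ρ.twistGenus_of_typeS hg, h]
    · simp [hg, hf, hg', hf', this, ρ.twistGenus_of_typeS hg, h]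
    · exact absurd h h2
  · have hf' : ¬ ρ.TypeD H.f := not_not_intro hf
    have hg' : ρ.TypeD H.g := hg
    have := ρ.sameCycle_twist_of_typeD_typeS H.f_ne_g H.f_ne_rev_g H.rev_f_ne_g
      H.rev_f_ne_rev_g hg hf
    simp [hg, hf', this]
  · have hf' : ρ.TypeD H.f := hf
    have hg' : ρ.TypeD H.g := hg
    have := ρ.sameCycle_twist_of_typeD_typeD H.f_ne_g H.f_ne_rev_g H.rev_f_ne_g
      H.rev_f_ne_rev_g hg hf
    rcases H.shared_cases_of_typeD hf' with h | h | h <;>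
    simp [hg, hf, hg', hf', this, ρ.twistGenus_of_typeD hg, h, eq_sub_iff_add_eq]

theorem B1_eq : H.B1 = H.twistCount True := by
  have hG := surjective_src_of_isRootEdge H.isRoot_g
  funext i
  simp only [B1, DS, DD2, SS0, SS1, DS0, DS1, offset, Pi.add_apply, count_eq_sum hG,
    ← Finset.sum_add_distrib, twistCount]
  refine Finset.sum_congr rfl fun ρ _ => ?_
  by_cases hg : ρ.TypeS H.g <;> by_cases hf : ρ.TypeS H.f
  · have hg' : ¬ ρ.TypeD H.g := not_not_intro hg
    have hf' : ¬ ρ.TypeD H.f := not_not_intro hf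
    have := ρ.sameCycle_twist_of_typeS_typeS H.f_ne_g H.f_ne_rev_g H.rev_f_ne_g
      H.rev_f_ne_rev_g hg hf
    rcases H.shared_cases_of_typeS hf with h | h <;>
    simp [hg, hf, hg', hf', this, ρ.twistGenus_of_typeS hg, h]
  · have hg' : ¬ ρ.TypeD H.g := not_not_intro hg
    have := ρ.not_sameCycle_twist_of_typeS_typeD H.f_ne_g H.f_ne_rev_g H.rev_f_ne_g
      H.rev_f_ne_rev_g hg hf
    simp [hf, hg', this]
  · have hf' : ¬ ρ.TypeD H.f := not_not_intro hf
    have hg' : ρ.TypeD H.g := hg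
    have := ρ.sameCycle_twist_of_typeD_typeS H.f_ne_g H.f_ne_rev_g H.rev_f_ne_g
      H.rev_f_ne_rev_g hg hf
    rcases H.shared_cases_of_typeS hf with h | h <;>
    simp [hg, hf, hg', hf', this, ρ.twistGenus_of_typeD hg, h, eq_sub_iff_add_eq]
  · have hf' : ρ.TypeD H.f := hf
    have hg' : ρ.TypeD H.g := hg
    have := ρ.sameCycle_twist_of_typeD_typeD H.f_ne_g H.f_ne_rev_g H.rev_f_ne_g
      H.rev_f_ne_rev_g hg hf
    simp [hg, hf, hg', hf', this, ρ.twistGenus_of_typeD hg, eq_sub_iff_add_eq]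

/-- The refinement by `g` sums out: the classes involved exhaust type D at `f`. -/
theorem A2_eq : H.A2 = H.straightCount False := by
  have hG := surjective_src_of_isRootEdge H.isRoot_g
  funext i
  simp only [A2, SD, DD, DD0, DD1, DD2, SD0, SD1, Pi.add_apply, count_eq_sum hG,
    ← Finset.sum_add_distrib, straightCount]
  refine Finset.sum_congr rfl fun ρ _ => ?_
  rw [show SameCycle ρ.next H.f (H.rev H.f) ↔ ρ.TypeS H.f from (ρ.face_eq_iff _ _).symm]
  by_cases hf : ρ.TypeS H.f
  · have hf' : ¬ ρ.TypeD H.f := not_not_intro hf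
    simp [hf, hf']
  · have hf' : ρ.TypeD H.f := hf
    by_cases hg : ρ.TypeS H.g
    · have hg' : ¬ ρ.TypeD H.g := not_not_intro hg
      have h2 := H.shared_ne_two hg hf
      rcases H.shared_cases_of_typeD hf' with h | h | h
      · simp [hg, hf, hg', hf', h]
      · simp [hg, hf, hg', hf', h]
      · exact absurd h h2
    · have hg' : ρ.TypeD H.g := hg
      rcases H.shared_cases_of_typeD hf' with h | h | h <;> simp [hg, hf, hg', hf', h]

theorem B2_eq : H.B2 = H.straightCount True := by
  have hG := surjective_src_of_isRootEdge H.isRoot_g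
  funext i
  simp only [B2, SS, DS, SS0, SS1, SS2, DS0, DS1, Pi.add_apply, count_eq_sum hG,
    ← Finset.sum_add_distrib, straightCount]
  refine Finset.sum_congr rfl fun ρ _ => ?_
  rw [show SameCycle ρ.next H.f (H.rev H.f) ↔ ρ.TypeS H.f from (ρ.face_eq_iff _ _).symm]
  by_cases hf : ρ.TypeS H.f
  · by_cases hg : ρ.TypeS H.g
    · have hg' : ¬ ρ.TypeD H.g := not_not_intro hg
      by_cases ha : ρ.Alternating H.g H.f <;>
      rcases H.shared_cases_of_typeS hf with h | h <;> simp [hg, hf, hg', h, ha]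
    · have hg' : ρ.TypeD H.g := hg
      rcases H.shared_cases_of_typeS hf with h | h <;> simp [hg, hf, hg', h]
  · simp [hf]

end DoublyEdgeRooted

/-! ### Sequences -/

/-- Transitivity b/a ≤ d/c ≤ f/e in cross-multiplied form; only the middle ratio has to be free of
zeros. -/
theorem Nat.mul_le_mul_of_ratio_chain {a b c d e f : ℕ} (h₁ : b * c ≤ a * d) (h₂ : d * e ≤ c * f)
    (hc : c ≠ 0) (hd : d ≠ 0) : b * e ≤ a * f := by
  refine Nat.le_of_mul_le_mul_right ?_ (Nat.mul_pos (Nat.pos_of_ne_zero hc)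
    (Nat.pos_of_ne_zero hd))
  calc b * e * (c * d) = b * c * (d * e) := by ring
    _ ≤ a * d * (c * f) := Nat.mul_le_mul h₁ h₂
    _ = a * f * (c * d) := by ring

theorem Nat.mul_le_of_ne_zero {a b c : ℕ} (h : a ≠ 0 → b ≠ 0 → a * b ≤ c) : a * b ≤ c := by
  rcases Nat.eq_zero_or_pos a with ha | ha
  · simp [ha]
  rcases Nat.eq_zero_or_pos b with hb | hb
  · simp [hb]
  exact h ha.ne' hb.ne'

theorem NoInternalZeros.ne_zero {a : ℤ → ℕ} (h : NoInternalZeros a) {i k j : ℤ} (hi : a i ≠ 0)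
    (hj : a j ≠ 0) (hik : i ≤ k) (hkj : k ≤ j) : a k ≠ 0 := by
  rcases hik.eq_or_lt with rfl | h1
  · exact hi
  rcases hkj.eq_or_lt with rfl | h2
  · exact hj
  exact h i k j h1 h2 (mul_ne_zero hi hj)

theorem LogConcave.mul_le_mul {a : ℤ → ℕ} (h : LogConcave a) (hz : NoInternalZeros a) {l u : ℤ}
    (hlu : l ≤ u) : a (u + 1) * a l ≤ a u * a (l + 1) := by
  induction u, hlu using Int.leInduction with
  | base => rw [mul_comm]
  | succ u hu ih =>
    refine Nat.mul_le_of_ne_zero fun h1 h2 => ?_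
    have h3 : a u ≠ 0 := hz.ne_zero h2 h1 hu (by omega)
    have h4 : a (u + 1) ≠ 0 := hz.ne_zero h2 h1 (by omega) (by omega)
    have h5 := h (u + 1)
    rw [add_sub_cancel_right, sq, mul_comm] at h5
    exact Nat.mul_le_mul_of_ratio_chain h5 ih h3 h4

theorem RatioDominated.logConcave_add {d s : ℤ → ℕ} (h : RatioDominated d s) : LogConcave (d + s) := by
  intro k
  have h1 := h.1.1 k
  have h2 := h.1.2.1 k
  obtain ⟨h3, h4⟩ := h.1.2.2 k
  simp only [Pi.add_apply]
  nlinarith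

/-! ### Consequences of ratio-dominance at arbitrary distance. -/

section RatioDominated

variable {d s : ℤ → ℕ} (h : RatioDominated d s) (hz : NoInternalZeros (d + s))

include h hz

/-- Inside the support of `d + s`, a zero of `d` makes `s` nonzero there, and ratio-dominance then
forces the next entry of `d` to vanish. Zeros of `d` thus propagate to the right; those of `s`
propagate to the left in the companion lemma. -/
theorem RatioDominated.noInternalZeros_left : NoInternalZeros d := by
  intro i k j hik hkj hij hk
  obtain ⟨hi, hj⟩ := mul_ne_zero_iff.1 hij
  have hU : ∀ m, i ≤ m → m ≤ j → (d + s) m ≠ 0 := fun m h1 h2 =>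
    hz.ne_zero (by simp [hi]) (by simp [hj]) h1 h2
  have key : ∀ m, k ≤ m → m ≤ j → d m = 0 := by
    intro m hm
    induction m, hm using Int.leInduction with
    | base => exact fun _ => hk
    | succ m hm ih =>
      intro hm'
      have h1 := ih (by omega)
      have h2 := hU m (by omega) (by omega)
      have h3 := h.2 m
      simp only [Pi.add_apply, h1, zero_add, zero_mul, nonpos_iff_eq_zero, mul_eq_zero] at h2 h3
      exact h3.resolve_right h2
  exact hj (key j hkj.le le_rfl)

theorem RatioDominated.noInternalZeros_right : NoInternalZeros s := by
  intro i k j hik hkj hij hk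
  obtain ⟨hi, hj⟩ := mul_ne_zero_iff.1 hij
  have hU : ∀ m, i ≤ m → m ≤ j → (d + s) m ≠ 0 := fun m h1 h2 =>
    hz.ne_zero (by simp [hi]) (by simp [hj]) h1 h2
  have key : ∀ m, m ≤ k → i ≤ m → s m = 0 := by
    intro m hm
    induction m, hm using Int.leInductionDown with
    | base => exact fun _ => hk
    | pred m hm ih =>
      intro hm'
      have h1 := ih (by omega)
      have h2 := hU m (by omega) (by omega)
      have h3 := h.2 (m - 1)
      simp only [Pi.add_apply, sub_add_cancel, h1, add_zero, mul_zero, nonpos_iff_eq_zero,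
        mul_eq_zero] at h2 h3
      exact h3.resolve_left h2
  exact hi (key i hik.le le_rfl)

/-- Chain d(u+1)/d(u) ≤ s(u+1)/s(u) ≤ s(l+1)/s(l): ratio-dominance, then log-concavity of `s`. -/
theorem RatioDominated.mul_le_left_right {l u : ℤ} (hlu : l ≤ u) :
    d (u + 1) * s l ≤ d u * s (l + 1) := by
  refine Nat.mul_le_of_ne_zero fun h1 h2 => ?_
  have hU : ∀ m, l ≤ m → m ≤ u + 1 → (d + s) m ≠ 0 := fun m h3 h4 =>
    hz.ne_zero (by simp [h2]) (by simp [h1]) h3 h4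
  have key : ∀ m, l ≤ m → m ≤ u + 1 → s m ≠ 0 := by
    intro m hm
    induction m, hm using Int.leInduction with
    | base => exact fun _ => h2
    | succ m hm ih =>
      intro hm' h0
      have h3 := ih (by omega)
      have h4 := hU (m + 1) (by omega) hm'
      have h5 := h.2 m
      simp_all
  have h3 := h.1.2.1.mul_le_mul (h.noInternalZeros_right hz) hlu
  exact Nat.mul_le_mul_of_ratio_chain (h.2 u) h3 (key u hlu (by omega))
    (key (u + 1) (by omega) le_rfl)

/-- Chain s(u+1)/s(u) ≤ d(u)/d(u-1) ≤ d(l+1)/d(l). The first step is synchronicity, which costs one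
place; hence the strict inequality of the indices. -/
theorem RatioDominated.mul_le_right_left {l u : ℤ} (hlu : l < u) :
    s (u + 1) * d l ≤ s u * d (l + 1) := by
  refine Nat.mul_le_of_ne_zero fun h1 h2 => ?_
  have hU : ∀ m, l ≤ m → m ≤ u + 1 → (d + s) m ≠ 0 := fun m h3 h4 =>
    hz.ne_zero (by simp [h2]) (by simp [h1]) h3 h4
  have hu : d u ≠ 0 := by
    intro hu
    have key : ∀ m, m ≤ u → l ≤ m → d m = 0 ∧ s (m + 1) ≠ 0 := by
      intro m hm
      induction m, hm using Int.leInductionDown with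
      | base => exact fun _ => ⟨hu, h1⟩
      | pred m hm ih =>
        intro hm'
        obtain ⟨h3, h4⟩ := ih (by omega)
        have h5 := hU m (by omega) (by omega)
        have h6 := (h.1.2.2 m).1
        simp only [Pi.add_apply, h3, zero_add, zero_mul, nonpos_iff_eq_zero,
          mul_eq_zero] at h5 h6
        rw [sub_add_cancel]
        exact ⟨h6.resolve_right h4, h5⟩
    exact h2 (key l hlu.le le_rfl).1
  have hu' : d (u - 1) ≠ 0 :=
    (h.noInternalZeros_left hz).ne_zero h2 hu (by omega) (by omega)
  have h3 := h.1.1.mul_le_mul (h.noInternalZeros_left hz) (show l ≤ u - 1 by omega)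
  rw [sub_add_cancel] at h3
  have h4 := (h.1.2.2 u).1
  rw [mul_comm, mul_comm (d u)] at h4
  exact Nat.mul_le_mul_of_ratio_chain h4 h3 hu' hu

end RatioDominated

/-- The interleaving of two sequences. -/
def interleave (a₁ a₂ : ℤ → ℕ) (p : ℤ) : ℕ := if p % 2 = 0 then a₁ (p / 2) else a₂ (p / 2)

@[simp] theorem interleave_two_mul (a₁ a₂ : ℤ → ℕ) (t : ℤ) :
    interleave a₁ a₂ (2 * t) = a₁ t := by
  simp [interleave]

@[simp] theorem interleave_two_mul_add_one (a₁ a₂ : ℤ → ℕ) (t : ℤ) :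
    interleave a₁ a₂ (2 * t + 1) = a₂ t := by
  have h : (2 * t + 1) / 2 = t := by omega
  simp [interleave, h]

/-! ### The lexicographic condition in terms of interleaved sequences. -/

section Lexicographic

variable {a₁ a₂ b₁ b₂ : ℤ → ℕ}

/-- The comparison within `t` is the passage from an even to an odd index, and the comparison with
`t + 1` the passage back to an even one. A single monotone ratio results. -/
theorem LexCondition.mul_le_succ (h : LexCondition a₁ a₂ b₁ b₂) (p : ℤ) :
    interleave a₁ a₂ (p + 1) * interleave b₁ b₂ p ≤
      interleave a₁ a₂ p * interleave b₁ b₂ (p + 1) := by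
  obtain ⟨t, rfl | rfl⟩ := Int.even_or_odd' p
  · have := (h t).1.1
    simp only [interleave_two_mul, interleave_two_mul_add_one]
    unfold RatioLE at this
    linarith
  · have := (h t).1.2
    have e : 2 * t + 1 + 1 = 2 * (t + 1) := by ring
    simp only [e, interleave_two_mul, interleave_two_mul_add_one]
    unfold RatioLE at this
    linarith

/-- The offset by one in `t` becomes an offset by two in the interleaved index. -/
theorem LexCondition.mul_le_succ_offset (h : LexCondition a₁ a₂ b₁ b₂) (p : ℤ) :
    interleave b₁ b₂ (p + 1) * interleave a₁ a₂ (p - 2) ≤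
      interleave b₁ b₂ p * interleave a₁ a₂ (p - 1) := by
  obtain ⟨t, rfl | rfl⟩ := Int.even_or_odd' p
  · have := (h t).2.1
    have e : 2 * t - 1 = 2 * (t - 1) + 1 := by ring
    have e' : 2 * t - 2 = 2 * (t - 1) := by ring
    simp only [e, e', interleave_two_mul, interleave_two_mul_add_one]
    unfold RatioLE at this
    linarith
  · have := (h t).2.2
    have e : 2 * t + 1 + 1 = 2 * (t + 1) := by ring
    have e' : 2 * t + 1 - 2 = 2 * (t - 1) + 1 := by ring
    have e'' : 2 * t + 1 - 1 = 2 * t := by ring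
    simp only [e, e', e'', interleave_two_mul, interleave_two_mul_add_one]
    unfold RatioLE at this
    linarith

end Lexicographic

/-! ### From consecutive ratios to minors of order two at arbitrary distance. -/

section Minors

variable {α β : ℤ → ℕ} (h₁ : ∀ p, α (p + 1) * β p ≤ α p * β (p + 1))
  (h₂ : ∀ p, β (p + 1) * α (p - 2) ≤ β p * α (p - 1)) (hz : NoInternalZeros (α + β))

include h₁ hz

/-- Within the support of α + β, the support of α is an initial segment and, by the next lemma, that
of β a final one: α/β can become zero but never recover. -/
theorem ne_zero_of_le_left {p q : ℤ} (hpq : p ≤ q) (hp : (α + β) p ≠ 0) (hq : α q ≠ 0) :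
    α p ≠ 0 := by
  have key : ∀ m, m ≤ q → p ≤ m → α m ≠ 0 := by
    intro m hm
    induction m, hm using Int.leInductionDown with
    | base => exact fun _ => hq
    | pred m hm ih =>
      intro hm' h0
      have h3 := ih (by omega)
      have h4 : (α + β) (m - 1) ≠ 0 := hz.ne_zero (j := q) hp (by simp [hq]) hm' (by omega)
      have h5 := h₁ (m - 1)
      rw [sub_add_cancel] at h5
      simp_all
  exact key p hpq le_rfl

theorem ne_zero_of_le_right {p q : ℤ} (hpq : p ≤ q) (hp : β p ≠ 0) (hq : (α + β) q ≠ 0) :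
    β q ≠ 0 := by
  have key : ∀ m, p ≤ m → m ≤ q → β m ≠ 0 := by
    intro m hm
    induction m, hm using Int.leInduction with
    | base => exact fun _ => hp
    | succ m hm ih =>
      intro hm' h0
      have h3 := ih (by omega)
      have h4 : (α + β) (m + 1) ≠ 0 := hz.ne_zero (i := p) (by simp [hp]) hq (by omega) hm'
      have h5 := h₁ m
      simp_all
  exact key q hpq le_rfl

theorem cross_mul_le {p q : ℤ} (hpq : p ≤ q) : α q * β p ≤ α p * β q := by
  refine Nat.mul_le_of_ne_zero fun hq hp => ?_
  have hU : ∀ m, p ≤ m → m ≤ q → (α + β) m ≠ 0 := fun m h3 h4 =>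
    hz.ne_zero (by simp [hp]) (by simp [hq]) h3 h4
  have key : ∀ m, p ≤ m → m ≤ q → α m * β p ≤ β m * α p := by
    intro m hm
    induction m, hm using Int.leInduction with
    | base => intro _; rw [mul_comm]
    | succ m hm ih =>
      intro hm'
      have h3 := h₁ m
      rw [mul_comm (α m)] at h3
      have h4 := hU m hm (by omega)
      exact Nat.mul_le_mul_of_ratio_chain h3 (ih (by omega))
        (ne_zero_of_le_right h₁ hz hm hp h4) (ne_zero_of_le_left h₁ hz (by omega) h4 hq)
  rw [mul_comm (α p)]
  exact key q hpq le_rfl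

include h₂

/-- Some entry of β is nonzero by assumption. If it lies beyond `y`, walking down from it cannot
meet a zero of β: α would be nonzero at that place, hence also two places earlier, against `h₂`. -/
theorem ne_zero_of_add_two_le_right (hβ : β ≠ 0) {x y : ℤ} (hxy : x + 2 ≤ y) (hx : α x ≠ 0)
    (hy : (α + β) y ≠ 0) : β y ≠ 0 := by
  obtain ⟨z, hz'⟩ := Function.ne_iff.1 hβ
  rw [Pi.zero_apply] at hz'
  rcases le_total z y with h | h
  · exact ne_zero_of_le_right h₁ hz h hz' hy
  have hU : ∀ m, x ≤ m → m ≤ z → (α + β) m ≠ 0 := fun m h3 h4 =>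
    hz.ne_zero (by simp [hx]) (by simp [hz']) h3 h4
  have key : ∀ m, m ≤ z → y ≤ m → β m ≠ 0 := by
    intro m hm
    induction m, hm using Int.leInductionDown with
    | base => exact fun _ => hz'
    | pred m hm ih =>
      intro hm' h0
      have h3 := ih (by omega)
      have h4 := hU (m - 1) (by omega) (by omega)
      have h5 : α (m - 1 - 2) ≠ 0 := ne_zero_of_le_left h₁ hz (q := m - 1) (by omega)
        (hU _ (by omega) (by omega)) (by simpa [h0] using h4)
      have h6 := h₂ (m - 1)
      rw [sub_add_cancel] at h6
      simp_all
  exact key y h le_rfl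

theorem ne_zero_of_add_two_le_left (hα : α ≠ 0) {x z : ℤ} (hxz : x + 2 ≤ z) (hz' : β z ≠ 0)
    (hx : (α + β) x ≠ 0) : α x ≠ 0 := by
  obtain ⟨w, hw⟩ := Function.ne_iff.1 hα
  rw [Pi.zero_apply] at hw
  rcases le_total x w with h | h
  · exact ne_zero_of_le_left h₁ hz h hx hw
  have hU : ∀ m, w ≤ m → m ≤ z → (α + β) m ≠ 0 := fun m h3 h4 =>
    hz.ne_zero (by simp [hw]) (by simp [hz']) h3 h4
  have key : ∀ m, w ≤ m → m ≤ x → α m ≠ 0 := by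
    intro m hm
    induction m, hm using Int.leInduction with
    | base => exact fun _ => hw
    | succ m hm ih =>
      intro hm' h0
      have h3 := ih (by omega)
      have h4 := hU (m + 1) (by omega) (by omega)
      have h5 : β (m + 2 + 1) ≠ 0 := ne_zero_of_le_right h₁ hz (p := m + 1) (by omega)
        (by simpa [h0] using h4) (hU _ (by omega) (by omega))
      have h6 := h₂ (m + 2)
      rw [add_sub_cancel_right, show m + 2 - 1 = m + 1 by ring] at h6
      simp_all
  exact key x h le_rfl

variable (hα : α ≠ 0) (hβ : β ≠ 0)

include hα hβ

/-- Iterating `h₂` needs β nonzero on `[p, q]` and α nonzero two places earlier; this is what the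
two preceding lemmas supply. The three remaining shifted minors follow by combining this one with
`cross_mul_le`. -/
theorem cross_mul_le_right_left_offset {p q : ℤ} (hpq : p ≤ q) :
    β q * α (p - 2) ≤ β p * α (q - 2) := by
  refine Nat.mul_le_of_ne_zero fun hq hp => ?_
  have hU : ∀ m, p - 2 ≤ m → m ≤ q → (α + β) m ≠ 0 := fun m h3 h4 =>
    hz.ne_zero (by simp [hp]) (by simp [hq]) h3 h4
  have key : ∀ m, p ≤ m → m ≤ q → β m * α (p - 2) ≤ α (m - 2) * β p := by
    intro m hm
    induction m, hm using Int.leInduction with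
    | base => intro _; rw [mul_comm]
    | succ m hm ih =>
      intro hm'
      have h3 := h₂ m
      rw [mul_comm (β m), show m - 1 = m + 1 - 2 by ring] at h3
      exact Nat.mul_le_mul_of_ratio_chain h3 (ih (by omega))
        (ne_zero_of_add_two_le_left h₁ h₂ hz hα (by omega) hq (hU _ (by omega) (by omega)))
        (ne_zero_of_add_two_le_right h₁ h₂ hz hβ (by omega) hp (hU _ (by omega) (by omega)))
  rw [mul_comm (β p)]
  exact key q hpq le_rfl

theorem cross_mul_le_left_left_offset {p q : ℤ} (hpq : p ≤ q) :
    α q * α (p - 2) ≤ α p * α (q - 2) := by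
  refine Nat.mul_le_of_ne_zero fun hq hp => ?_
  have hU : ∀ m, p - 2 ≤ m → m ≤ q → (α + β) m ≠ 0 := fun m h3 h4 =>
    hz.ne_zero (by simp [hp]) (by simp [hq]) h3 h4
  exact Nat.mul_le_mul_of_ratio_chain (cross_mul_le h₁ hz hpq)
    (cross_mul_le_right_left_offset h₁ h₂ hz hα hβ hpq)
    (ne_zero_of_add_two_le_right h₁ h₂ hz hβ (by omega) hp (hU _ (by omega) (by omega)))
    (ne_zero_of_add_two_le_right h₁ h₂ hz hβ (by omega) hp (hU _ (by omega) (by omega)))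

theorem cross_mul_le_right_right_offset {p q : ℤ} (hpq : p ≤ q) :
    β q * β (p - 2) ≤ β p * β (q - 2) := by
  refine Nat.mul_le_of_ne_zero fun hq hp => ?_
  have hU : ∀ m, p - 2 ≤ m → m ≤ q → (α + β) m ≠ 0 := fun m h3 h4 =>
    hz.ne_zero (by simp [hp]) (by simp [hq]) h3 h4
  exact Nat.mul_le_mul_of_ratio_chain (cross_mul_le_right_left_offset h₁ h₂ hz hα hβ hpq)
    (cross_mul_le h₁ hz (by omega))
    (ne_zero_of_add_two_le_left h₁ h₂ hz hα (by omega) hq (hU _ (by omega) (by omega)))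
    (ne_zero_of_add_two_le_left h₁ h₂ hz hα (by omega) hq (hU _ (by omega) (by omega)))

theorem cross_mul_le_left_right_offset {p q : ℤ} (hpq : p ≤ q) :
    α q * β (p - 2) ≤ α p * β (q - 2) := by
  refine Nat.mul_le_of_ne_zero fun hq hp => ?_
  have hU : ∀ m, p - 2 ≤ m → m ≤ q → (α + β) m ≠ 0 := fun m h3 h4 =>
    hz.ne_zero (by simp [hp]) (by simp [hq]) h3 h4
  exact Nat.mul_le_mul_of_ratio_chain (cross_mul_le h₁ hz hpq)
    (cross_mul_le_right_right_offset h₁ h₂ hz hα hβ hpq)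
    (ne_zero_of_le_right h₁ hz (by omega) hp (hU _ (by omega) (by omega)))
    (ne_zero_of_le_right h₁ hz (by omega) hp (hU _ (by omega) (by omega)))

end Minors

/-! ### The recurrence as a matrix product. -/

/-- The Cauchy–Binet inequality for products of matrices with nonnegative minors of order two. -/
theorem Finset.sum_mul_sum_le_of_minors {ι : Type*} [LinearOrder ι] (T : Finset ι)
    (x y m n : ι → ℕ) (hxy : ∀ p q, p < q → x q * y p ≤ x p * y q)
    (hmn : ∀ p q, p < q → n p * m q ≤ m p * n q) :
    (∑ p ∈ T, x p * n p) * (∑ q ∈ T, y q * m q) ≤ (∑ p ∈ T, x p * m p) * ∑ q ∈ T, y q * n q := by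
  have hnn : (0 : ℤ) ≤ ∑ p ∈ T, ∑ q ∈ T,
      ((x p : ℤ) * y q - x q * y p) * ((m p : ℤ) * n q - n p * m q) := by
    refine Finset.sum_nonneg fun p _ => Finset.sum_nonneg fun q _ => ?_
    rcases lt_trichotomy p q with h | rfl | h
    · have h1 : (x q : ℤ) * y p ≤ x p * y q := by exact_mod_cast hxy p q h
      have h2 : (n p : ℤ) * m q ≤ m p * n q := by exact_mod_cast hmn p q h
      exact mul_nonneg (by linarith) (by linarith)
    · simp
    · have h1 : (x p : ℤ) * y q ≤ x q * y p := by exact_mod_cast hxy q p h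
      have h2 : (n q : ℤ) * m p ≤ m q * n p := by exact_mod_cast hmn q p h
      exact mul_nonneg_of_nonpos_of_nonpos (by linarith) (by linarith)
  have e : ∑ p ∈ T, ∑ q ∈ T, ((x p : ℤ) * y q - x q * y p) * ((m p : ℤ) * n q - n p * m q) =
      2 * ((∑ p ∈ T, (x p : ℤ) * m p) * (∑ q ∈ T, (y q : ℤ) * n q) -
        (∑ p ∈ T, (x p : ℤ) * n p) * (∑ q ∈ T, (y q : ℤ) * m q)) := by
    have e1 : ∀ p q, ((x p : ℤ) * y q - x q * y p) * ((m p : ℤ) * n q - n p * m q) =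
        x p * m p * (y q * n q) - x p * n p * (y q * m q) +
          (x q * m q * (y p * n p) - x q * n q * (y p * m p)) := by
      intro p q; ring
    simp only [e1, Finset.sum_add_distrib, Finset.sum_sub_distrib]
    rw [Finset.sum_comm (f := fun p q => (x q : ℤ) * m q * (y p * n p)),
      Finset.sum_comm (f := fun p q => (x q : ℤ) * n q * (y p * m p))]
    simp only [← Finset.sum_mul_sum]
    ring
  rw [e] at hnn
  zify
  linarith

theorem finsum_mul_finsum_le_of_minors {ι : Type*} [LinearOrder ι] {x y m n : ι → ℕ}
    (hx : x.support.Finite) (hy : y.support.Finite)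
    (hxy : ∀ p q, p < q → x q * y p ≤ x p * y q) (hmn : ∀ p q, p < q → n p * m q ≤ m p * n q) :
    (∑ᶠ p, x p * n p) * (∑ᶠ q, y q * m q) ≤ (∑ᶠ p, x p * m p) * ∑ᶠ q, y q * n q := by
  classical
  have hX : ∀ w : ι → ℕ, ∑ᶠ p, x p * w p = ∑ p ∈ hx.toFinset ∪ hy.toFinset, x p * w p := by
    intro w
    refine finsum_eq_sum_of_support_subset _ fun p hp => ?_
    simp only [Finset.coe_union, Set.Finite.coe_toFinset, Set.mem_union, Function.mem_support]
    exact Or.inl (left_ne_zero_of_mul hp)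
  have hY : ∀ w : ι → ℕ, ∑ᶠ p, y p * w p = ∑ p ∈ hx.toFinset ∪ hy.toFinset, y p * w p := by
    intro w
    refine finsum_eq_sum_of_support_subset _ fun p hp => ?_
    simp only [Finset.coe_union, Set.Finite.coe_toFinset, Set.mem_union, Function.mem_support]
    exact Or.inr (left_ne_zero_of_mul hp)
  rw [hX, hX, hY, hY]
  exact Finset.sum_mul_sum_le_of_minors _ _ _ _ _ hxy hmn

/-- The sequences with which the interleaved sequences of the amalgamand are combined. -/
def amalgamRow (d s : ℤ → ℕ) (p k : ℤ) : ℕ :=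
  interleave (fun t => 2 * d (k - t)) (fun t => 2 * d (k - t) + 4 * s (k - t)) p

/-- The entries depend only on `k - t` and the parity of `p`, and one unit of `t` is two units of
`p`. -/
theorem amalgamRow_sub (d s : ℤ → ℕ) (p k : ℤ) :
    amalgamRow d s (p - 2) (k - 1) = amalgamRow d s p k := by
  unfold amalgamRow
  obtain ⟨t, rfl | rfl⟩ := Int.even_or_odd' p
  · rw [show 2 * t - 2 = 2 * (t - 1) by ring, interleave_two_mul, interleave_two_mul]
    simp only [sub_sub_sub_cancel_right]
  · rw [show 2 * t + 1 - 2 = 2 * (t - 1) + 1 by ring, interleave_two_mul_add_one,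
      interleave_two_mul_add_one]
    simp only [sub_sub_sub_cancel_right]

/-- Each minor is a nonnegative combination of order-two minors of `d` and `s`. Those needing the
strict inequality of `mul_le_right_left` occur only for odd `p`, where `p < q` gives `i < j`. -/
theorem RatioDominated.amalgamRow_minor {d s : ℤ → ℕ} (h : RatioDominated d s)
    (hz : NoInternalZeros (d + s)) (k : ℤ) {p q : ℤ} (hpq : p < q) :
    amalgamRow d s p (k + 1) * amalgamRow d s q k ≤
      amalgamRow d s p k * amalgamRow d s q (k + 1) := by
  have hdd : ∀ {l u : ℤ}, l ≤ u → d (u + 1) * d l ≤ d u * d (l + 1) :=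
    fun hlu => h.1.1.mul_le_mul (h.noInternalZeros_left hz) hlu
  have hss : ∀ {l u : ℤ}, l ≤ u → s (u + 1) * s l ≤ s u * s (l + 1) :=
    fun hlu => h.1.2.1.mul_le_mul (h.noInternalZeros_right hz) hlu
  have hds : ∀ {l u : ℤ}, l ≤ u → d (u + 1) * s l ≤ d u * s (l + 1) := h.mul_le_left_right hz
  have hsd : ∀ {l u : ℤ}, l < u → s (u + 1) * d l ≤ s u * d (l + 1) := h.mul_le_right_left hz
  unfold amalgamRow
  obtain ⟨i, rfl | rfl⟩ := Int.even_or_odd' p <;> obtain ⟨j, rfl | rfl⟩ := Int.even_or_odd' q <;>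
    simp only [interleave_two_mul, interleave_two_mul_add_one,
      show k + 1 - i = k - i + 1 by ring, show k + 1 - j = k - j + 1 by ring]
  · have h1 := hdd (show k - j ≤ k - i by omega)
    linarith
  · have h1 := hdd (show k - j ≤ k - i by omega)
    have h2 := hds (show k - j ≤ k - i by omega)
    linarith
  · have h1 := hdd (show k - j ≤ k - i by omega)
    have h2 := hsd (show k - j < k - i by omega)
    linarith
  · have h1 := hdd (show k - j ≤ k - i by omega)
    have h2 := hds (show k - j ≤ k - i by omega)
    have h3 := hsd (show k - j < k - i by omega)
    have h4 := hss (show k - j ≤ k - i by omega)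
    linarith

/-- Ratio-dominance is preserved by the linear recurrences with lexicographic coefficients. -/
theorem RatioDominated.finsum_amalgamRow {d s : ℤ → ℕ} (h : RatioDominated d s)
    (hz : NoInternalZeros (d + s)) {α β : ℤ → ℕ}
    (h₁ : ∀ p, α (p + 1) * β p ≤ α p * β (p + 1))
    (h₂ : ∀ p, β (p + 1) * α (p - 2) ≤ β p * α (p - 1)) (hz' : NoInternalZeros (α + β))
    (hα : α ≠ 0) (hβ : β ≠ 0) (hα' : α.support.Finite) (hβ' : β.support.Finite) :
    RatioDominated (fun k => ∑ᶠ p, α p * amalgamRow d s p k)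
      (fun k => ∑ᶠ p, β p * amalgamRow d s p k) := by
  have hshift : ∀ (γ : ℤ → ℕ) (k : ℤ), ∑ᶠ p, γ p * amalgamRow d s p (k - 1) =
      ∑ᶠ p, γ (p - 2) * amalgamRow d s p k := by
    intro γ k
    rw [← finsum_comp_equiv (Equiv.subRight (2 : ℤ))]
    simp only [Equiv.subRight_apply, amalgamRow_sub]
  have hfin : ∀ γ : ℤ → ℕ, γ.support.Finite → (fun p => γ (p - 2)).support.Finite := by
    intro γ hγ
    exact (hγ.preimage (Equiv.subRight (2 : ℤ)).injective.injOn)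
  have hrow := fun k p q hpq => h.amalgamRow_minor hz k (p := p) (q := q) hpq
  -- Pairing a sequence with its own shift by two yields log-concavity, pairing it with the shift of
  -- the other one yields synchronicity, and the unshifted pair yields ratio-dominance.
  have hαα := fun k => finsum_mul_finsum_le_of_minors hα' (hfin α hα')
    (fun p q hpq => cross_mul_le_left_left_offset h₁ h₂ hz' hα hβ hpq.le) (hrow k)
  have hββ := fun k => finsum_mul_finsum_le_of_minors hβ' (hfin β hβ')
    (fun p q hpq => cross_mul_le_right_right_offset h₁ h₂ hz' hα hβ hpq.le) (hrow k)
  have hαβ := fun k => finsum_mul_finsum_le_of_minors hα' hβ'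
    (fun p q hpq => cross_mul_le h₁ hz' hpq.le) (hrow k)
  have hβα := fun k => finsum_mul_finsum_le_of_minors hβ' (hfin α hα')
    (fun p q hpq => cross_mul_le_right_left_offset h₁ h₂ hz' hα hβ hpq.le) (hrow k)
  have hαβ' := fun k => finsum_mul_finsum_le_of_minors hα' (hfin β hβ')
    (fun p q hpq => cross_mul_le_left_right_offset h₁ h₂ hz' hα hβ hpq.le) (hrow k)
  simp only [← hshift, add_sub_cancel_right] at hαα hββ hβα hαβ'
  refine ⟨⟨fun k => ?_, fun k => ?_, fun k => ⟨?_, ?_⟩⟩, hαβ⟩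
  · rw [sq, mul_comm]; exact hαα k
  · rw [sq, mul_comm]; exact hββ k
  · beta_reduce; rw [mul_comm, mul_comm (∑ᶠ p, α p * amalgamRow d s p k)]; exact hβα k
  · exact hαβ' k

/-! ### Embeddings of an edge-amalgamation -/

namespace MultiGraph

open Equiv Equiv.Perm

/-- The vertex at which the dart `d` starts is 2-valent, and `x` is the other dart that starts
there. -/
structure IsOther (G : MultiGraph) (d x : G.Dart) : Prop where
  ne : x ≠ d
  src_eq : G.src x = G.src d
  eq_or : ∀ z, G.src z = G.src d → z = d ∨ z = x

variable {G : MultiGraph}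

theorem exists_isOther {d : G.Dart} (h : G.valence (G.src d) = 2) : ∃ x, G.IsOther d x := by
  obtain ⟨⟨a, ha⟩, ⟨b, hb⟩, hab, huniv⟩ := Nat.card_eq_two_iff.1 h
  have hab' : a ≠ b := fun h => hab (Subtype.ext h)
  have hall : ∀ z, G.src z = G.src d → z = a ∨ z = b := by
    intro z hz
    have : (⟨z, hz⟩ : {x // G.src x = G.src d}) ∈ ({⟨a, ha⟩, ⟨b, hb⟩} : Set _) :=
      huniv ▸ Set.mem_univ _
    simpa using this
  rcases hall d rfl with rfl | rfl
  · exact ⟨b, hab'.symm, hb, hall⟩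
  · exact ⟨a, hab', ha, fun z hz => (hall z hz).symm⟩

theorem Embedding.rot_ne_self (ρ : Embedding G) {d x : G.Dart} (hne : x ≠ d)
    (hsrc : G.src x = G.src d) : ρ.rot d ≠ d := fun h =>
  hne (SameCycle.eq_of_left ((ρ.sameCycle_iff d x).2 hsrc.symm) h).symm

theorem IsOther.rot_eq {d x : G.Dart} (h : G.IsOther d x) (ρ : Embedding G) : ρ.rot d = x :=
  (h.eq_or _ (ρ.src_rot d)).resolve_left (ρ.rot_ne_self h.ne h.src_eq)

theorem IsOther.symm {d x : G.Dart} (h : G.IsOther d x) : G.IsOther x d :=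
  ⟨h.ne.symm, h.src_eq.symm, fun z hz => (h.eq_or z (hz.trans h.src_eq)).symm⟩

theorem IsRootEdge.exists_isOther {e : G.Dart} (h : G.IsRootEdge e) :
    ∃ x x', G.IsOther e x ∧ G.IsOther (G.rev e) x' := by
  obtain ⟨x, hx⟩ := MultiGraph.exists_isOther h.2.1
  obtain ⟨x', hx'⟩ := MultiGraph.exists_isOther h.2.2
  exact ⟨x, x', hx, hx'⟩

end MultiGraph

/-! ### Rotations, faces and genus of a spliced embedding. -/

namespace Amalgam

open Equiv Equiv.Perm MultiGraph

open scoped Classical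

variable {G : EdgeRooted} {H : DoublyEdgeRooted}

theorem vertH_eq_inl {v : H.V} {u : G.V} (h : vertH G H v = Sum.inl u) :
    (v = H.src H.g ∧ u = G.src G.e) ∨ (v = H.src (H.rev H.g) ∧ u = G.src (G.rev G.e)) := by
  unfold vertH at h
  split_ifs at h with h1 h2
  · exact Or.inl ⟨h1, (Sum.inl.inj h).symm⟩
  · exact Or.inr ⟨h2, (Sum.inl.inj h).symm⟩

theorem vertH_injective : Function.Injective (vertH G H) := by
  intro v w h
  by_cases h1 : v = H.src H.g
  · subst h1
    rw [vertH_g] at h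
    rcases vertH_eq_inl h.symm with h | h
    · exact h.1.symm
    · exact absurd h.2 G.isRoot.1
  by_cases h2 : v = H.src (H.rev H.g)
  · subst h2
    rw [vertH_rev_g] at h
    rcases vertH_eq_inl h.symm with h | h
    · exact absurd h.2.symm G.isRoot.1
    · exact h.1.symm
  rw [vertH_of_ne G H h1 h2] at h
  unfold vertH at h
  split_ifs at h
  exact congrArg Subtype.val (Sum.inr.inj h)

/-- The darts of the amalgamated graph, as darts of the disjoint union. -/
def toSum : (graph G H).Dart → G.Dart ⊕ H.Dart := Sum.map id Subtype.val

/-- A dart of `G` as a dart of the amalgamated graph. -/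
def inlDart (x : G.Dart) : (graph G H).Dart := Sum.inl x

/-- A dart of `H`, not on the edge `g`, as a dart of the amalgamated graph. -/
def inrDart (d : H.Dart) (h₁ : d ≠ H.g) (h₂ : d ≠ H.rev H.g) : (graph G H).Dart :=
  Sum.inr ⟨d, h₁, h₂⟩

theorem dart_cases {P : (graph G H).Dart → Prop} (hl : ∀ x, P (inlDart x))
    (hr : ∀ d h₁ h₂, P (inrDart d h₁ h₂)) (t : (graph G H).Dart) : P t := by
  rcases t with x | ⟨d, h₁, h₂⟩
  · exact hl x
  · exact hr d h₁ h₂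

@[simp] theorem toSum_inlDart (x : G.Dart) : toSum (inlDart (H := H) x) = Sum.inl x := rfl

@[simp] theorem toSum_inrDart (d : H.Dart) (h₁ : d ≠ H.g) (h₂ : d ≠ H.rev H.g) :
    toSum (inrDart (G := G) d h₁ h₂) = Sum.inr d := rfl

theorem toSum_injective : Function.Injective (toSum (G := G) (H := H)) :=
  Sum.map_injective.2 ⟨Function.injective_id, Subtype.val_injective⟩

theorem mem_range_toSum {k : G.Dart ⊕ H.Dart} :
    k ∈ Set.range (toSum (G := G) (H := H)) ↔
      k ≠ Sum.inr H.g ∧ k ≠ Sum.inr (H.rev H.g) := by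
  constructor
  · rintro ⟨t, rfl⟩
    induction t using dart_cases with
    | hl x => exact ⟨by simp, by simp⟩
    | hr d h1 h2 => exact ⟨by simpa using h1, by simpa using h2⟩
  · rcases k with x | d
    · exact fun _ => ⟨Sum.inl x, rfl⟩
    · rintro ⟨h1, h2⟩
      exact ⟨Sum.inr ⟨d, by simpa using h1, by simpa using h2⟩, rfl⟩

/-- The vertex of the amalgamated graph at which a dart of the disjoint union starts. -/
noncomputable def srcSum : G.Dart ⊕ H.Dart → Vert G H
  | Sum.inl x => Sum.inl (G.src x)
  | Sum.inr d => vertH G H (H.src d)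

theorem srcSum_toSum (t : (graph G H).Dart) : srcSum (toSum t) = (graph G H).src t := by
  rcases t with x | d <;> rfl

variable {p q : G.Dart} (hp : G.src p = G.src G.e) (hq : G.src q = G.src (G.rev G.e))
  (ρ : Embedding G.toMultiGraph) (ρ' : Embedding H.toMultiGraph)

theorem ne_of_src (hp : G.src p = G.src G.e) (hq : G.src q = G.src (G.rev G.e)) : p ≠ q := by
  rintro rfl
  exact G.isRoot.1 (hp.symm.trans hq)

theorem g_ne_rev_g : H.g ≠ H.rev H.g := (H.rev_ne H.g).symm

include hp hq

theorem srcSum_splice (k : G.Dart ⊕ H.Dart) :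
    srcSum (splice p q H.g (H.rev H.g) ρ.rot ρ'.rot k) = srcSum k := by
  have hpq := ne_of_src hp hq
  rcases k with x | d
  · rw [splice_inl hpq g_ne_rev_g]
    have hx := ρ.src_rot x
    split_ifs with h1 h2
    · rw [h1, hp] at hx
      simp only [srcSum, vertH_g, hx]
    · rw [h2, hq] at hx
      simp only [srcSum, vertH_rev_g, hx]
    · simp only [srcSum, hx]
  · rw [splice_inr hpq g_ne_rev_g]
    have hd := ρ'.src_rot d
    split_ifs with h1 h2
    · rw [h1] at hd
      simp only [srcSum, ← hd, vertH_g, hp]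
    · rw [h2] at hd
      simp only [srcSum, ← hd, vertH_rev_g, hq]
    · simp only [srcSum, hd]

/-- Splicing the rotations at `p` and `q` joins the vertex of `G` at each end of `e` to the matching
end of `g` and joins nothing else. -/
theorem sameCycle_splice_iff (k l : G.Dart ⊕ H.Dart) :
    SameCycle (splice p q H.g (H.rev H.g) ρ.rot ρ'.rot) k l ↔ srcSum k = srcSum l := by
  constructor
  · intro h
    refine SameCycle.rel_of_step (r := fun k l => srcSum k = srcSum l) (fun _ => rfl)
      (fun x y hxy => ?_) h
    rw [hxy, srcSum_splice hp hq]
  · have hpq : ¬ SameCycle ρ.rot p q := by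
      rw [ρ.sameCycle_iff, hp, hq]
      exact G.isRoot.1
    have hinl : ∀ {x y : G.Dart}, G.src x = G.src y →
        SameCycle (splice p q H.g (H.rev H.g) ρ.rot ρ'.rot) (Sum.inl x) (Sum.inl y) :=
      fun h => sameCycle_splice_inl_inl hpq ((ρ.sameCycle_iff _ _).2 h)
    have hinr : ∀ {x y : H.Dart}, H.src x = H.src y →
        SameCycle (splice p q H.g (H.rev H.g) ρ.rot ρ'.rot) (Sum.inr x) (Sum.inr y) :=
      fun h => (sameCycle_splice_inr_inr hpq _ _).2 ((ρ'.sameCycle_iff _ _).2 h)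
    have hmix : ∀ {x : G.Dart} {y : H.Dart}, vertH G H (H.src y) = Sum.inl (G.src x) →
        SameCycle (splice p q H.g (H.rev H.g) ρ.rot ρ'.rot) (Sum.inl x) (Sum.inr y) := by
      intro x y h
      rcases vertH_eq_inl h with ⟨h1, h2⟩ | ⟨h1, h2⟩
      · exact (hinl (h2.trans hp.symm)).trans ((sameCycle_splice_left hpq).trans (hinr h1.symm))
      · exact (hinl (h2.trans hq.symm)).trans ((sameCycle_splice_right hpq).trans (hinr h1.symm))
    intro h
    rcases k with x | x <;> rcases l with y | y
    · exact hinl (Sum.inl.inj h)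
    · exact hmix h.symm
    · exact (hmix h).symm
    · exact hinr (vertH_injective h)

/-- The successor of a dart of `g` is the other dart at its 2-valent end, which is not on `g` as the
two ends are distinct. So the darts of `g` are skipped one at a time. -/
theorem splice_mem_range {k : G.Dart ⊕ H.Dart} (hk : k ∉ Set.range (toSum (G := G) (H := H))) :
    splice p q H.g (H.rev H.g) ρ.rot ρ'.rot k ∈ Set.range (toSum (G := G) (H := H)) := by
  have hpq := ne_of_src hp hq
  obtain ⟨y, y', hy, hy'⟩ := H.isRoot_g.exists_isOther
  have hsrc := H.isRoot_g.1
  rw [mem_range_toSum] at hk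
  have hk' : k = Sum.inr H.g ∨ k = Sum.inr (H.rev H.g) := by tauto
  rw [mem_range_toSum]
  rcases hk' with rfl | rfl
  · have h1 : y ≠ H.rev H.g := fun h => hsrc (by rw [← h, hy.src_eq])
    rw [splice_inr hpq g_ne_rev_g, hy.rot_eq, if_neg hy.ne, if_neg h1]
    simp [hy.ne, h1]
  · have h1 : y' ≠ H.g := fun h => hsrc (by rw [← hy'.src_eq, h])
    rw [splice_inr hpq g_ne_rev_g, hy'.rot_eq, if_neg hy'.ne, if_neg h1]
    simp [hy'.ne, h1]

theorem exists_embedding : ∃ ρW : Embedding (graph G H),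
    IsReturn (splice p q H.g (H.rev H.g) ρ.rot ρ'.rot) toSum ρW.rot := by
  obtain ⟨N, hN⟩ := exists_isReturn (M := splice p q H.g (H.rev H.g) ρ.rot ρ'.rot)
    (toSum_injective (G := G) (H := H)) (fun t => by
      by_cases h : splice p q H.g (H.rev H.g) ρ.rot ρ'.rot (toSum t) ∈
        Set.range (toSum (G := G) (H := H))
      · exact Or.inl h
      · exact Or.inr (splice_mem_range hp hq ρ ρ' h))
  refine ⟨⟨N, fun d d' => ?_⟩, hN⟩
  rw [hN.sameCycle_iff toSum_injective, sameCycle_splice_iff hp hq, srcSum_toSum, srcSum_toSum]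
  exact Iff.rfl

theorem next_splice_mem_range {k : G.Dart ⊕ H.Dart}
    (hk : k ∉ Set.range (toSum (G := G) (H := H))) :
    splice p q H.g (H.rev H.g) ρ.next (ρ'.twist H.g) k ∈
      Set.range (toSum (G := G) (H := H)) := by
  have hk' := hk
  rw [mem_range_toSum] at hk
  have h1 : k = Sum.inr H.g ∨ k = Sum.inr (H.rev H.g) := by tauto
  have hpq := ne_of_src hp hq
  have h2 : splice p q H.g (H.rev H.g) ρ.next (ρ'.twist H.g) k =
      splice p q H.g (H.rev H.g) ρ.rot ρ'.rot k := by
    have e1 : ρ'.twist H.g H.g = ρ'.rot H.g := by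
      change ρ'.rot (H.rev (swap H.g (H.rev H.g) H.g)) = _
      rw [swap_apply_left, H.rev_rev]
    have e2 : ρ'.twist H.g (H.rev H.g) = ρ'.rot (H.rev H.g) := by
      change ρ'.rot (H.rev (swap H.g (H.rev H.g) (H.rev H.g))) = _
      rw [swap_apply_right]
    rcases h1 with rfl | rfl
    · rw [splice_inr hpq g_ne_rev_g, splice_inr hpq g_ne_rev_g, e1]
    · rw [splice_inr hpq g_ne_rev_g, splice_inr hpq g_ne_rev_g, e2]
  rw [h2]
  exact splice_mem_range hp hq ρ ρ' hk'

section Faces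

variable {ρ ρ'} {ρW : Embedding (graph G H)}
  (hρ : IsReturn (splice p q H.g (H.rev H.g) ρ.rot ρ'.rot) toSum ρW.rot)

include hρ

-- Composing reversal in `H` with the transposition of the two darts of `g` fixes both. Reversal is
-- then compatible with skipping them, and `twist` appears in place of the face tracing of `H`.
omit hp hq in
theorem isReturn_next :
    IsReturn (splice p q H.g (H.rev H.g) ρ.next (ρ'.twist H.g)) toSum ρW.next := by
  have hM : splice p q H.g (H.rev H.g) ρ.next (ρ'.twist H.g) =
      splice p q H.g (H.rev H.g) ρ.rot ρ'.rot *
        Perm.sumCongr G.revPerm (H.revPerm * swap H.g (H.rev H.g)) := by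
    rw [splice_mul_sumCongr, ← mul_assoc]
    rfl
  have hrev : ∀ t : (graph G H).Dart,
      Perm.sumCongr G.revPerm (H.revPerm * swap H.g (H.rev H.g)) (toSum t) =
        toSum ((graph G H).rev t) := by
    rintro (x | ⟨d, h1, h2⟩)
    · rfl
    · change Sum.inr (H.rev (swap H.g (H.rev H.g) d)) = Sum.inr (H.rev d)
      rw [swap_apply_of_ne_of_ne h1 h2]
  have hfix : ∀ k, k ∉ Set.range (toSum (G := G) (H := H)) →
      Perm.sumCongr G.revPerm (H.revPerm * swap H.g (H.rev H.g)) k = k := by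
    intro k hk
    rw [mem_range_toSum] at hk
    have hk' : k = Sum.inr H.g ∨ k = Sum.inr (H.rev H.g) := by tauto
    rcases hk' with rfl | rfl
    · change Sum.inr (H.rev (swap H.g (H.rev H.g) H.g)) = _
      rw [swap_apply_left, H.rev_rev]
    · change Sum.inr (H.rev (swap H.g (H.rev H.g) (H.rev H.g))) = _
      rw [swap_apply_right]
  intro t
  rw [hM, mul_apply, hrev]
  rcases hρ ((graph G H).rev t) with h | ⟨h1, h2⟩
  · exact Or.inl h
  · refine Or.inr ⟨h1, ?_⟩
    rw [mul_apply, hfix _ h1]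
    exact h2

theorem numCycles_next :
    numCycles ρW.next = numCycles (splice p q H.g (H.rev H.g) ρ.next (ρ'.twist H.g)) :=
  (isReturn_next hρ).numCycles_eq toSum_injective
    fun _ hk => next_splice_mem_range hp hq ρ ρ' hk

theorem numCycles_next_of_not_sameCycle (h : ¬ SameCycle ρ.next p q) :
    numCycles ρW.next + 2 = numCycles ρ.next + numCycles (ρ'.twist H.g) := by
  rw [numCycles_next hp hq hρ, numCycles_splice h]

omit hp hq in
theorem sameCycle_next_of_not_sameCycle (h : ¬ SameCycle ρ.next p q)
    {d d' : H.Dart} (h₁ : d ≠ H.g) (h₂ : d ≠ H.rev H.g) (h₁' : d' ≠ H.g)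
    (h₂' : d' ≠ H.rev H.g) :
    SameCycle ρW.next (inrDart d h₁ h₂) (inrDart d' h₁' h₂') ↔ SameCycle (ρ'.twist H.g) d d' := by
  rw [(isReturn_next hρ).sameCycle_iff toSum_injective]
  exact sameCycle_splice_inr_inr h _ _

/-- `splice_swap_mul` exchanges the twist of `H` for `swap p q` on the side of `G`. That
transposition splits the common face, gaining one cycle, and the splice then loses two. -/
theorem numCycles_next_of_sameCycle (h : SameCycle ρ.next p q) :
    numCycles ρW.next + 1 = numCycles ρ.next + numCycles ρ'.next := by
  have hpq := ne_of_src hp hq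
  have h1 := numCycles_splice (g := H.g) (g' := H.rev H.g) (τ := ρ'.next)
    (not_sameCycle_swap_mul hpq h)
  rw [splice_swap_mul hpq g_ne_rev_g, numCycles_conj, numCycles_swap_mul_of_sameCycle hpq h] at h1
  have h2 := numCycles_next hp hq hρ
  rw [Embedding.twist] at h2
  omega

theorem sameCycle_next_of_sameCycle (h : SameCycle ρ.next p q)
    {d d' : H.Dart} (h₁ : d ≠ H.g) (h₂ : d ≠ H.rev H.g) (h₁' : d' ≠ H.g)
    (h₂' : d' ≠ H.rev H.g) :
    SameCycle ρW.next (inrDart d h₁ h₂) (inrDart d' h₁' h₂') ↔ SameCycle ρ'.next d d' := by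
  have hpq := ne_of_src hp hq
  rw [(isReturn_next hρ).sameCycle_iff toSum_injective,
    ← sameCycle_splice_inr_inr (g := H.g) (g' := H.rev H.g) (τ := ρ'.next)
      (not_sameCycle_swap_mul hpq h), splice_swap_mul hpq g_ne_rev_g, sameCycle_conj, swap_inv,
    swap_apply_of_ne_of_ne (by simpa using h₁) (by simpa using h₂),
    swap_apply_of_ne_of_ne (by simpa using h₁') (by simpa using h₂')]
  rfl

end Faces

omit hp hq

theorem card_subtype_ne_add_two {α : Type*} [Finite α] {a b : α} (h : a ≠ b) :
    Nat.card {x : α // x ≠ a ∧ x ≠ b} + 2 = Nat.card α := by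
  have := Fintype.ofFinite α
  rw [Nat.card_eq_fintype_card, Nat.card_eq_fintype_card, Fintype.card_subtype]
  have h1 : (Finset.univ.filter fun x : α => x ≠ a ∧ x ≠ b) = Finset.univ \ {a, b} := by
    ext x; simp
  have h2 := Finset.card_sdiff_add_card_eq_card (Finset.subset_univ ({a, b} : Finset α))
  rw [Finset.card_pair h, Finset.card_univ] at h2
  rw [h1, h2]

theorem card_vert : Nat.card (graph G H).V + 2 = Nat.card G.V + Nat.card H.V := by
  have h1 : Nat.card (graph G H).V = Nat.card G.V +
      Nat.card {v : H.V // v ≠ H.src H.g ∧ v ≠ H.src (H.rev H.g)} := Nat.card_sum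
  rw [h1, add_assoc, card_subtype_ne_add_two H.isRoot_g.1]

theorem card_dart : Nat.card (graph G H).Dart + 2 = Nat.card G.Dart + Nat.card H.Dart := by
  have h1 : Nat.card (graph G H).Dart = Nat.card G.Dart +
      Nat.card {d : H.Dart // d ≠ H.g ∧ d ≠ H.rev H.g} := Nat.card_sum
  rw [h1, add_assoc, card_subtype_ne_add_two g_ne_rev_g]

section Genus

variable {ρ ρ'} {ρW : Embedding (graph G H)}
  (hρ : IsReturn (splice p q H.g (H.rev H.g) ρ.rot ρ'.rot) toSum ρW.rot)

include hp hq hρ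

/-- The amalgam has two vertices, one edge and two cycles fewer than the parts: 2 + 2 - 1 + 2 = 2 +
3, which explains the 3 in `twistGenus`. Evenness of the numerator for `G` lets the halves be added.
-/
theorem genus_of_not_sameCycle (h : ¬ SameCycle ρ.next p q) :
    ρW.genus = ρ.genus + ρ'.twistGenus H.g := by
  have h1 := numCycles_next_of_not_sameCycle hp hq hρ h
  have h2 := card_vert (G := G) (H := H)
  have h3 := card_dart (G := G) (H := H)
  have h4 := ρ.two_dvd_euler (surjective_src_of_isRootEdge G.isRoot)
  have h5 := G.two_mul_numCycles_revPerm
  have h6 := H.two_mul_numCycles_revPerm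
  unfold Embedding.genus Embedding.twistGenus
  omega

theorem genus_of_sameCycle (h : SameCycle ρ.next p q) :
    ρW.genus = ρ.genus + ρ'.genus := by
  have h1 := numCycles_next_of_sameCycle hp hq hρ h
  have h2 := card_vert (G := G) (H := H)
  have h3 := card_dart (G := G) (H := H)
  have h4 := ρ.two_dvd_euler (surjective_src_of_isRootEdge G.isRoot)
  have h5 := G.two_mul_numCycles_revPerm
  have h6 := H.two_mul_numCycles_revPerm
  unfold Embedding.genus
  omega

end Genus

end Amalgam

namespace Amalgam

open Equiv Equiv.Perm MultiGraph

open scoped Classical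

variable {G : EdgeRooted} {H : DoublyEdgeRooted}

/-! #### The correspondence of the embeddings -/

theorem return_apply_of_eq {M : Perm (G.Dart ⊕ H.Dart)} {N : Perm (graph G H).Dart}
    (h : IsReturn M toSum N) {t s : (graph G H).Dart} (hts : M (toSum t) = toSum s) : N t = s := by
  rcases h t with h1 | ⟨h1, -⟩
  · exact toSum_injective (h1.symm.trans hts)
  · exact absurd ⟨s, hts.symm⟩ h1

theorem return_apply_of_not_mem {M : Perm (G.Dart ⊕ H.Dart)} {N : Perm (graph G H).Dart}
    (h : IsReturn M toSum N) {t s : (graph G H).Dart}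
    (ht : M (toSum t) ∉ Set.range (toSum (G := G) (H := H)))
    (hts : M (M (toSum t)) = toSum s) : N t = s := by
  rcases h t with h1 | ⟨-, h1⟩
  · exact absurd ⟨_, h1.symm⟩ ht
  · exact toSum_injective (h1.symm.trans hts)

theorem inlDart_injective : Function.Injective (inlDart (G := G) (H := H)) := Sum.inl_injective

theorem inlDart_ne_inrDart (x : G.Dart) (d : H.Dart) (h₁ : d ≠ H.g) (h₂ : d ≠ H.rev H.g) :
    inlDart x ≠ inrDart (G := G) d h₁ h₂ := Sum.inl_ne_inr

theorem inrDart_inj {d d' : H.Dart} {h₁ h₂ h₁' h₂'}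
    (h : inrDart (G := G) d h₁ h₂ = inrDart d' h₁' h₂') : d = d' :=
  congrArg Subtype.val (Sum.inr.inj h)

variable {y y' : H.Dart} (hy : H.IsOther H.g y) (hy' : H.IsOther (H.rev H.g) y')

include hy in
theorem ne_rev_g_of_isOther : y ≠ H.rev H.g := fun h => H.isRoot_g.1 (by rw [← h, hy.src_eq])

include hy' in
theorem ne_g_of_isOther : y' ≠ H.g := fun h => H.isRoot_g.1 (by rw [← hy'.src_eq, h])

include hy hy' in
theorem ne_of_isOther : y ≠ y' := fun h =>
  H.isRoot_g.1 (by rw [← hy'.src_eq, ← h, hy.src_eq])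

section Values

variable {p q : G.Dart} (hp : G.src p = G.src G.e) (hq : G.src q = G.src (G.rev G.e))
  {ρ : Embedding G.toMultiGraph} {ρ' : Embedding H.toMultiGraph} {N : Perm (graph G H).Dart}
  (h : IsReturn (splice p q H.g (H.rev H.g) ρ.rot ρ'.rot) toSum N)

include hp hq h

theorem return_inrDart {d : H.Dart} (h₁ : d ≠ H.g) (h₂ : d ≠ H.rev H.g) :
    toSum (N (inrDart d h₁ h₂)) = if ρ'.rot d = H.g then Sum.inl p
      else if ρ'.rot d = H.rev H.g then Sum.inl q else Sum.inr (ρ'.rot d) := by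
  have key := splice_inr (ne_of_src hp hq) g_ne_rev_g ρ.rot ρ'.rot d
  rw [← key]
  rw [← toSum_inrDart (G := G) d h₁ h₂] at key ⊢
  rcases h (inrDart d h₁ h₂) with h3 | ⟨h3, -⟩
  · exact h3.symm
  · refine absurd ?_ h3
    rw [mem_range_toSum, key]
    split_ifs with h4 h5
    · simp
    · simp
    · simpa using ⟨h4, h5⟩

include hy hy'

theorem return_inlDart (x : G.Dart) :
    toSum (N (inlDart x)) = if ρ.rot x = p then Sum.inr y
      else if ρ.rot x = q then Sum.inr y' else Sum.inl (ρ.rot x) := by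
  have hpq := ne_of_src hp hq
  have key := splice_inl hpq g_ne_rev_g ρ.rot ρ'.rot x
  have hg := splice_inr hpq g_ne_rev_g ρ.rot ρ'.rot H.g
  have hg' := splice_inr hpq g_ne_rev_g ρ.rot ρ'.rot (H.rev H.g)
  rw [hy.rot_eq, if_neg hy.ne, if_neg (ne_rev_g_of_isOther hy)] at hg
  rw [hy'.rot_eq, if_neg (ne_g_of_isOther hy'), if_neg hy'.ne] at hg'
  rw [← toSum_inlDart (H := H) x] at key
  split_ifs at key ⊢ with h1 h2
  · rw [return_apply_of_not_mem h (s := inrDart y hy.ne (ne_rev_g_of_isOther hy))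
      (by rw [key, mem_range_toSum]; simp) (by rw [key]; exact hg)]
    rfl
  · rw [return_apply_of_not_mem h (s := inrDart y' (ne_g_of_isOther hy') hy'.ne)
      (by rw [key, mem_range_toSum]; simp) (by rw [key]; exact hg')]
    rfl
  · rw [return_apply_of_eq h (s := inlDart (ρ.rot x)) key]
    rfl

end Values

/-- The darts `p` and `q` can be read off as the successors of the inserted darts of `H`; after that
the rotation determines both parts. -/
theorem eq_of_isReturn {p q p₁ q₁ : G.Dart}
    (hp : G.src p = G.src G.e) (hq : G.src q = G.src (G.rev G.e))
    (hp₁ : G.src p₁ = G.src G.e) (hq₁ : G.src q₁ = G.src (G.rev G.e))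
    {ρ ρ₁ : Embedding G.toMultiGraph} {ρ' ρ'₁ : Embedding H.toMultiGraph}
    {N : Perm (graph G H).Dart}
    (h : IsReturn (splice p q H.g (H.rev H.g) ρ.rot ρ'.rot) toSum N)
    (h₁ : IsReturn (splice p₁ q₁ H.g (H.rev H.g) ρ₁.rot ρ'₁.rot) toSum N) :
    p = p₁ ∧ q = q₁ ∧ ρ = ρ₁ ∧ ρ' = ρ'₁ := by
  obtain ⟨y, y', hy, hy'⟩ := H.isRoot_g.exists_isOther
  have hpp : p = p₁ := by
    have e := return_inrDart hp hq h hy.ne (ne_rev_g_of_isOther hy)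
    have e₁ := return_inrDart hp₁ hq₁ h₁ hy.ne (ne_rev_g_of_isOther hy)
    rw [hy.symm.rot_eq, if_pos rfl] at e e₁
    exact Sum.inl.inj (e.symm.trans e₁)
  have hqq : q = q₁ := by
    have e := return_inrDart hp hq h (ne_g_of_isOther hy') hy'.ne
    have e₁ := return_inrDart hp₁ hq₁ h₁ (ne_g_of_isOther hy') hy'.ne
    rw [hy'.symm.rot_eq, if_neg g_ne_rev_g.symm, if_pos rfl] at e e₁
    exact Sum.inl.inj (e.symm.trans e₁)
  subst hpp hqq
  have hpq := ne_of_src hp hq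
  have hyy := ne_of_isOther hy hy'
  refine ⟨rfl, rfl, Embedding.rot_injective (Equiv.ext fun x => ?_),
    Embedding.rot_injective (Equiv.ext fun d => ?_)⟩
  · have e := (return_inlDart hy hy' hp hq h x).symm.trans (return_inlDart hy hy' hp hq h₁ x)
    split_ifs at e <;> simp_all
  · by_cases hd1 : d = H.g
    · rw [hd1, hy.rot_eq, hy.rot_eq]
    by_cases hd2 : d = H.rev H.g
    · rw [hd2, hy'.rot_eq, hy'.rot_eq]
    have e := (return_inrDart hp hq h hd1 hd2).symm.trans (return_inrDart hp hq h₁ hd1 hd2)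
    split_ifs at e <;> simp_all

/-- The darts of `H` in the amalgamated graph. -/
noncomputable def ofH (G : EdgeRooted) (H : DoublyEdgeRooted) (d : H.Dart) : (graph G H).Dart :=
  if h₁ : d = H.g then inlDart G.e
  else if h₂ : d = H.rev H.g then inlDart (G.rev G.e) else inrDart d h₁ h₂

theorem ofH_g : ofH G H H.g = inlDart G.e := by simp [ofH]

theorem ofH_rev_g : ofH G H (H.rev H.g) = inlDart (G.rev G.e) := by
  simp [ofH, g_ne_rev_g.symm]

theorem ofH_of_ne {d : H.Dart} (h₁ : d ≠ H.g) (h₂ : d ≠ H.rev H.g) :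
    ofH G H d = inrDart d h₁ h₂ := by
  simp [ofH, h₁, h₂]

theorem ofH_injective : Function.Injective (ofH G H) := by
  have he : G.e ≠ G.rev G.e := (G.rev_ne _).symm
  intro a b h
  unfold ofH at h
  split_ifs at h with h1 h2 h3 h4 h5 h6 h7 h8
  · rw [h1, h2]
  · exact absurd (inlDart_injective h) he
  · exact absurd h (inlDart_ne_inrDart _ _ _ _)
  · exact absurd (inlDart_injective h).symm he
  · rw [h4, h6]
  · exact absurd h (inlDart_ne_inrDart _ _ _ _)
  · exact absurd h.symm (inlDart_ne_inrDart _ _ _ _)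
  · exact absurd h.symm (inlDart_ne_inrDart _ _ _ _)
  · exact inrDart_inj h

theorem src_inlDart (x : G.Dart) :
    (graph G H).src (inlDart x) = (Sum.inl (G.src x) : Vert G H) := rfl

theorem src_inrDart (d : H.Dart) (h₁ : d ≠ H.g) (h₂ : d ≠ H.rev H.g) :
    (graph G H).src (inrDart d h₁ h₂) = vertH G H (H.src d) := rfl

theorem src_ofH (d : H.Dart) : (graph G H).src (ofH G H d) = vertH G H (H.src d) := by
  by_cases h₁ : d = H.g
  · rw [h₁, ofH_g, vertH_g]; rfl
  by_cases h₂ : d = H.rev H.g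
  · rw [h₂, ofH_rev_g, vertH_rev_g]; rfl
  rw [ofH_of_ne h₁ h₂]; rfl

include hy hy' in
/-- A dart of `H` that is merged into a vertex of `G`. -/
theorem eq_of_src_eq_inl {d : H.Dart} (h₁ : d ≠ H.g) (h₂ : d ≠ H.rev H.g) {u : G.V}
    (h : vertH G H (H.src d) = Sum.inl u) :
    (d = y ∧ u = G.src G.e) ∨ (d = y' ∧ u = G.src (G.rev G.e)) := by
  rcases vertH_eq_inl h with ⟨h, hu⟩ | ⟨h, hu⟩
  · exact Or.inl ⟨(hy.eq_or d h).resolve_left h₁, hu⟩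
  · exact Or.inr ⟨(hy'.eq_or d h).resolve_left h₂, hu⟩

section Restrict

variable (ρW : Embedding (graph G H))

include hy hy'

/-- At a merged vertex only one dart of `H` survives, and it is not fixed by the rotation because a
dart of `e` is there too. Its successor must belong to `G`. -/
theorem exists_rot_inrDart :
    (∃ p, G.src p = G.src G.e ∧
      ρW.rot (inrDart y hy.ne (ne_rev_g_of_isOther hy)) = inlDart p) ∧
    ∃ q, G.src q = G.src (G.rev G.e) ∧
      ρW.rot (inrDart y' (ne_g_of_isOther hy') hy'.ne) = inlDart q := by
  constructor
  · have hs := ρW.src_rot (inrDart y hy.ne (ne_rev_g_of_isOther hy))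
    have hne := ρW.rot_ne_self (d := inrDart y hy.ne (ne_rev_g_of_isOther hy))
      (x := inlDart G.e) (inlDart_ne_inrDart _ _ _ _)
      (by rw [src_inrDart, hy.src_eq, vertH_g]; rfl)
    rw [src_inrDart, hy.src_eq, vertH_g] at hs
    generalize ρW.rot (inrDart y hy.ne (ne_rev_g_of_isOther hy)) = t at hs hne
    induction t using dart_cases with
    | hl p => exact ⟨p, Sum.inl.inj hs, rfl⟩
    | hr d h1 h2 =>
      rcases eq_of_src_eq_inl hy hy' h1 h2 hs with ⟨rfl, -⟩ | ⟨-, h⟩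
      · exact absurd rfl hne
      · exact absurd h G.isRoot.1
  · have hs := ρW.src_rot (inrDart y' (ne_g_of_isOther hy') hy'.ne)
    have hne := ρW.rot_ne_self (d := inrDart y' (ne_g_of_isOther hy') hy'.ne)
      (x := inlDart (G.rev G.e)) (inlDart_ne_inrDart _ _ _ _)
      (by rw [src_inrDart, hy'.src_eq, vertH_rev_g]; rfl)
    rw [src_inrDart, hy'.src_eq, vertH_rev_g] at hs
    generalize ρW.rot (inrDart y' (ne_g_of_isOther hy') hy'.ne) = t at hs hne
    induction t using dart_cases with
    | hl p => exact ⟨p, Sum.inl.inj hs, rfl⟩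
    | hr d h1 h2 =>
      rcases eq_of_src_eq_inl hy hy' h1 h2 hs with ⟨-, h⟩ | ⟨rfl, -⟩
      · exact absurd h.symm G.isRoot.1
      · exact absurd rfl hne

theorem eq_of_rot_inlDart_eq_inrDart {x : G.Dart} {d : H.Dart} {h₁ h₂}
    (h : ρW.rot (inlDart x) = inrDart d h₁ h₂) : d = y ∨ d = y' := by
  have hs := ρW.src_rot (inlDart x)
  rw [h, src_inrDart, src_inlDart] at hs
  exact (eq_of_src_eq_inl hy hy' h₁ h₂ hs).imp And.left And.left

/-- Between consecutive darts of `G` at most one dart of `H` is met, so first return restricts the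
rotation to `G`. -/
theorem exists_left_embedding : ∃ ρ : Embedding G.toMultiGraph,
    IsReturn ρW.rot (inlDart (G := G) (H := H)) ρ.rot := by
  obtain ⟨⟨p, -, hp⟩, q, -, hq⟩ := exists_rot_inrDart hy hy' ρW
  obtain ⟨N, hN⟩ := exists_isReturn (M := ρW.rot) (inlDart_injective (G := G) (H := H))
    (fun x => by
      generalize ht : ρW.rot (inlDart x) = t
      induction t using dart_cases with
      | hl z => exact Or.inl ⟨z, rfl⟩
      | hr d h1 h2 =>
        right
        rcases eq_of_rot_inlDart_eq_inrDart hy hy' ρW ht with rfl | rfl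
        · exact ⟨p, hp.symm⟩
        · exact ⟨q, hq.symm⟩)
  refine ⟨⟨N, fun a b => ?_⟩, hN⟩
  rw [hN.sameCycle_iff inlDart_injective, ρW.sameCycle_iff, src_inlDart, src_inlDart]
  exact Sum.inl_injective.eq_iff

-- Seen from `H`, the darts of `e` stand in for those of `g`, and at each merged vertex only the
-- other dart of `G` has to be skipped.
omit hy hy' in
theorem exists_right_embedding : ∃ ρ' : Embedding H.toMultiGraph,
    IsReturn ρW.rot (ofH G H) ρ'.rot := by
  obtain ⟨x, x', hx, hx'⟩ := G.isRoot.exists_isOther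
  have hmem : ∀ d h₁ h₂, inrDart d h₁ h₂ ∈ Set.range (ofH G H) :=
    fun d h₁ h₂ => ⟨d, ofH_of_ne h₁ h₂⟩
  have haux : ∀ (u : G.V) (z : G.Dart), u = G.src G.e ∨ u = G.src (G.rev G.e) → G.src z = u →
      (inlDart z : (graph G H).Dart) ∈ Set.range (ofH G H) ∨
        (u = G.src G.e ∧ z = x) ∨ (u = G.src (G.rev G.e) ∧ z = x') := by
    rintro u z (rfl | rfl) hz
    · rcases hx.eq_or z hz with rfl | rfl
      · exact Or.inl ⟨H.g, ofH_g⟩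
      · exact Or.inr (Or.inl ⟨rfl, rfl⟩)
    · rcases hx'.eq_or z hz with rfl | rfl
      · exact Or.inl ⟨H.rev H.g, ofH_rev_g⟩
      · exact Or.inr (Or.inr ⟨rfl, rfl⟩)
  obtain ⟨N, hN⟩ := exists_isReturn (M := ρW.rot) (ofH_injective (G := G) (H := H))
    (fun d => by
      have hs := ρW.src_rot (ofH G H d)
      rw [src_ofH] at hs
      generalize ρW.rot (ofH G H d) = t at hs
      induction t using dart_cases with
      | hr d h1 h2 => exact Or.inl (hmem _ _ _)
      | hl z =>
        rw [src_inlDart] at hs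
        have hu : G.src z = G.src G.e ∨ G.src z = G.src (G.rev G.e) :=
          (vertH_eq_inl hs.symm).imp And.right And.right
        by_cases hz : (inlDart z : (graph G H).Dart) ∈ Set.range (ofH G H)
        · exact Or.inl hz
        right
        have hs' := ρW.src_rot (inlDart z)
        have hne : ρW.rot (inlDart z) ≠ inlDart z := by
          rcases hu with hu | hu
          · refine ρW.rot_ne_self (x := inlDart G.e) (fun h => hz ?_) ?_
            · rw [← h]; exact ⟨H.g, ofH_g⟩
            · rw [src_inlDart, src_inlDart, hu]
          · refine ρW.rot_ne_self (x := inlDart (G.rev G.e)) (fun h => hz ?_) ?_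
            · rw [← h]; exact ⟨H.rev H.g, ofH_rev_g⟩
            · rw [src_inlDart, src_inlDart, hu]
        generalize ρW.rot (inlDart z) = t at hs' hne
        induction t using dart_cases with
        | hr d h1 h2 => exact hmem _ _ _
        | hl w =>
          rw [src_inlDart, src_inlDart] at hs'
          have h1 := haux _ z hu rfl
          have h2 := haux _ w hu (Sum.inl.inj hs')
          rcases h1.resolve_left hz with ⟨h3, h4⟩ | ⟨h3, h4⟩ <;>
            rcases h2 with h2 | ⟨h5, h6⟩ | ⟨h5, h6⟩
          · exact h2
          · exact absurd (by rw [h4, h6]) hne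
          · exact absurd (h3.symm.trans h5) G.isRoot.1
          · exact h2
          · exact absurd (h5.symm.trans h3) G.isRoot.1
          · exact absurd (by rw [h4, h6]) hne)
  refine ⟨⟨N, fun a b => ?_⟩, hN⟩
  rw [hN.sameCycle_iff ofH_injective, ρW.sameCycle_iff, src_ofH, src_ofH]
  exact vertH_injective.eq_iff

end Restrict

theorem exists_isReturn_splice (ρW : Embedding (graph G H)) :
    ∃ p q : G.Dart, G.src p = G.src G.e ∧ G.src q = G.src (G.rev G.e) ∧
      ∃ (ρ : Embedding G.toMultiGraph) (ρ' : Embedding H.toMultiGraph),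
        IsReturn (splice p q H.g (H.rev H.g) ρ.rot ρ'.rot) toSum ρW.rot := by
  obtain ⟨y, y', hy, hy'⟩ := H.isRoot_g.exists_isOther
  obtain ⟨⟨p, hp, hRp⟩, q, hq, hRq⟩ := exists_rot_inrDart hy hy' ρW
  obtain ⟨ρ, hρ⟩ := exists_left_embedding hy hy' ρW
  obtain ⟨ρ', hρ'⟩ := exists_right_embedding ρW
  refine ⟨p, q, hp, hq, ρ, ρ', fun t => ?_⟩
  have hpq := ne_of_src hp hq
  induction t using dart_cases with
  | hl x =>
    rw [toSum_inlDart, splice_inl hpq g_ne_rev_g]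
    rcases hρ x with h1 | ⟨h1, h2⟩
    · have h3 : ρ.rot x ≠ p := by
        intro h
        rw [h, ← hRp] at h1
        exact inlDart_ne_inrDart _ _ _ _ (ρW.rot.injective h1)
      have h4 : ρ.rot x ≠ q := by
        intro h
        rw [h, ← hRq] at h1
        exact inlDart_ne_inrDart _ _ _ _ (ρW.rot.injective h1)
      rw [if_neg h3, if_neg h4, h1]
      exact Or.inl rfl
    · right
      generalize ht : ρW.rot (inlDart x) = t at h1 h2
      induction t using dart_cases with
      | hl z => exact absurd ⟨z, rfl⟩ h1
      | hr d h3 h4 =>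
        rcases eq_of_rot_inlDart_eq_inrDart hy hy' ρW ht with rfl | rfl
        · rw [hRp] at h2
          have h5 : ρ.rot x = p := (inlDart_injective h2).symm
          rw [if_pos h5, mem_range_toSum, splice_inr hpq g_ne_rev_g, hy.rot_eq, if_neg h3,
            if_neg h4]
          simp
        · rw [hRq] at h2
          have h5 : ρ.rot x = q := (inlDart_injective h2).symm
          rw [h5, if_neg hpq.symm, if_pos rfl, mem_range_toSum, splice_inr hpq g_ne_rev_g,
            hy'.rot_eq, if_neg h3, if_neg h4]
          simp
  | hr d h1 h2 =>
    left
    rw [toSum_inrDart, splice_inr hpq g_ne_rev_g]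
    by_cases h3 : ρ'.rot d = H.g
    · have h4 : d = y := ρ'.rot.injective (h3.trans (hy.symm.rot_eq ρ').symm)
      subst h4
      rw [if_pos h3, hRp, toSum_inlDart]
    by_cases h4 : ρ'.rot d = H.rev H.g
    · have h5 : d = y' := ρ'.rot.injective (h4.trans (hy'.symm.rot_eq ρ').symm)
      subst h5
      rw [if_neg h3, if_pos h4, hRq, toSum_inlDart]
    rw [if_neg h3, if_neg h4]
    rcases hρ' d with h5 | ⟨h5, -⟩
    · rw [ofH_of_ne h1 h2, ofH_of_ne h3 h4] at h5
      rw [h5, toSum_inrDart]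
    · refine absurd ?_ h5
      rw [ofH_of_ne h1 h2]
      have hs := ρW.src_rot (inrDart d h1 h2)
      generalize ρW.rot (inrDart d h1 h2) = t at hs
      induction t using dart_cases with
      | hr d' h6 h7 => exact ⟨d', ofH_of_ne h6 h7⟩
      | hl z =>
        rw [src_inlDart, src_inrDart] at hs
        rcases eq_of_src_eq_inl hy hy' h1 h2 hs.symm with ⟨rfl, -⟩ | ⟨rfl, -⟩
        · exact absurd (hy.symm.rot_eq ρ') h3
        · exact absurd (hy'.symm.rot_eq ρ') h4

end Amalgam

/-! ### The recurrence for the partial genus distributions -/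

namespace EdgeRooted

open Equiv Equiv.Perm MultiGraph

open scoped Classical

variable (G : EdgeRooted)

theorem D_eq (i : ℤ) : G.D i = ∑ ρ : Embedding G.toMultiGraph,
    if ρ.genus = i ∧ (SameCycle ρ.next G.e (G.rev G.e) ↔ False) then 1 else 0 := by
  rw [D, count_eq_sum (surjective_src_of_isRootEdge G.isRoot)]
  refine Finset.sum_congr rfl fun ρ _ => if_congr (and_congr_right fun _ => ?_) rfl rfl
  rw [Embedding.TypeD, Ne, Embedding.face_eq_iff, iff_false]

theorem S_eq (i : ℤ) : G.S i = ∑ ρ : Embedding G.toMultiGraph,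
    if ρ.genus = i ∧ (SameCycle ρ.next G.e (G.rev G.e) ↔ True) then 1 else 0 := by
  rw [S, count_eq_sum (surjective_src_of_isRootEdge G.isRoot)]
  refine Finset.sum_congr rfl fun ρ _ => if_congr (and_congr_right fun _ => ?_) rfl rfl
  rw [Embedding.TypeS, Embedding.face_eq_iff, iff_true]

theorem D_add_S : G.D + G.S = G.genusDist := by
  funext i
  rw [Pi.add_apply, D, S, genusDist, count_eq_sum (surjective_src_of_isRootEdge G.isRoot),
    count_eq_sum (surjective_src_of_isRootEdge G.isRoot),
    count_eq_sum (surjective_src_of_isRootEdge G.isRoot), ← Finset.sum_add_distrib]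
  refine Finset.sum_congr rfl fun ρ _ => ?_
  by_cases h : ρ.TypeS G.e
  · have h' : ¬ ρ.TypeD G.e := not_not_intro h
    simp [h, h']
  · have h' : ρ.TypeD G.e := h
    simp [h, h']

/-- The genus distribution of a graph has no internal zeros. -/
theorem noInternalZeros_genusDist : NoInternalZeros G.genusDist := by
  have h : ∀ i, G.genusDist i ≠ 0 ↔ ∃ ρ : Embedding G.toMultiGraph, ρ.genus = i := by
    intro i
    rw [genusDist, count_eq_sum (surjective_src_of_isRootEdge G.isRoot)]
    simp
  intro i k j hik hkj hij
  obtain ⟨hi, hj⟩ := mul_ne_zero_iff.1 hij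
  rw [h] at hi hj ⊢
  obtain ⟨ρ₁, rfl⟩ := hi
  obtain ⟨ρ₂, rfl⟩ := hj
  exact Embedding.exists_genus_eq ρ₁ ρ₂ k hik.le hkj.le

end EdgeRooted

namespace Amalgam

open Equiv Equiv.Perm MultiGraph

open scoped Classical

variable {G : EdgeRooted} {H : DoublyEdgeRooted}

theorem root_eq : root G H = inrDart H.f H.f_ne_g H.f_ne_rev_g := rfl

theorem rev_root_eq : (graph G H).rev (root G H) =
    inrDart (H.rev H.f) H.rev_f_ne_g H.rev_f_ne_rev_g := rfl

section Cycles

variable {ρ : Embedding G.toMultiGraph} {x x' : G.Dart} (hx : G.IsOther G.e x)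
  (hx' : G.IsOther (G.rev G.e) x')

include hx in
theorem next_rev_e : ρ.next (G.rev G.e) = x := by
  change ρ.rot (G.rev (G.rev G.e)) = x
  rw [G.rev_rev, hx.rot_eq]

include hx' in
theorem next_e : ρ.next G.e = x' := hx'.rot_eq ρ

include hx' in
theorem sameCycle_e_other : SameCycle ρ.next G.e x' := by
  rw [← next_e hx', sameCycle_apply_right]

include hx in
theorem sameCycle_other_rev_e : SameCycle ρ.next x (G.rev G.e) := by
  rw [← next_rev_e hx, sameCycle_apply_left]

include hx hx' in
theorem sameCycle_other_other :
    SameCycle ρ.next x x' ↔ SameCycle ρ.next G.e (G.rev G.e) := by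
  rw [← next_rev_e (ρ := ρ) hx, ← next_e (ρ := ρ) hx', sameCycle_apply_left,
    sameCycle_apply_right, sameCycle_comm]

end Cycles

/-- The embeddings of the amalgamated graph, counted by genus and by the type at its root. -/
theorem sum_embedding_graph (b : Prop) (k : ℤ) :
    (∑ ρW : Embedding (graph G H), if ρW.genus = k ∧
      (SameCycle ρW.next (root G H) ((graph G H).rev (root G H)) ↔ b) then 1 else 0) =
    ∑ ρ : Embedding G.toMultiGraph, if SameCycle ρ.next G.e (G.rev G.e)
      then 4 * H.straightCount b (k - ρ.genus)
      else 2 * H.twistCount b (k - ρ.genus) + 2 * H.straightCount b (k - ρ.genus) := by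
  obtain ⟨x, x', hx, hx'⟩ := G.isRoot.exists_isOther
  -- The two Booleans record which dart of `G` follows the inserted dart of `H` at each end of `e`.
  let P : Bool → G.Dart := fun c => cond c G.e x
  let Q : Bool → G.Dart := fun c => cond c (G.rev G.e) x'
  have hP : ∀ c, G.src (P c) = G.src G.e := by
    rintro (_ | _)
    · exact hx.src_eq
    · rfl
  have hQ : ∀ c, G.src (Q c) = G.src (G.rev G.e) := by
    rintro (_ | _)
    · exact hx'.src_eq
    · rfl
  have hPinj : Function.Injective P := by
    rintro (_ | _) (_ | _) h
    · rfl
    · exact absurd h hx.ne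
    · exact absurd h.symm hx.ne
    · rfl
  have hQinj : Function.Injective Q := by
    rintro (_ | _) (_ | _) h
    · rfl
    · exact absurd h hx'.ne
    · exact absurd h.symm hx'.ne
    · rfl
  have hex : ∀ t : Embedding G.toMultiGraph × Embedding H.toMultiGraph × Bool × Bool,
      ∃ ρW : Embedding (graph G H), IsReturn
        (splice (P t.2.2.1) (Q t.2.2.2) H.g (H.rev H.g) t.1.rot t.2.1.rot) toSum ρW.rot :=
    fun t => exists_embedding (hP _) (hQ _) t.1 t.2.1
  choose F hF using hex
  have hbij : Function.Bijective F := by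
    constructor
    · rintro ⟨ρ, ρ', c, c'⟩ ⟨ρ₁, ρ'₁, c₁, c'₁⟩ h
      have h1 := hF (ρ, ρ', c, c')
      have h2 := hF (ρ₁, ρ'₁, c₁, c'₁)
      rw [h] at h1
      obtain ⟨h3, h4, rfl, rfl⟩ := eq_of_isReturn (hP _) (hQ _) (hP _) (hQ _) h1 h2
      have h3' : c = c₁ := hPinj h3
      have h4' : c' = c'₁ := hQinj h4
      rw [h3', h4']
    · intro ρW
      obtain ⟨p, q, hp, hq, ρ, ρ', h⟩ := exists_isReturn_splice ρW
      obtain ⟨c, rfl⟩ : ∃ c, P c = p := by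
        rcases hx.eq_or p hp with rfl | rfl
        · exact ⟨true, rfl⟩
        · exact ⟨false, rfl⟩
      obtain ⟨c', rfl⟩ : ∃ c, Q c = q := by
        rcases hx'.eq_or q hq with rfl | rfl
        · exact ⟨true, rfl⟩
        · exact ⟨false, rfl⟩
      exact ⟨(ρ, ρ', c, c'), Embedding.rot_injective
        (IsReturn.unique toSum_injective (hF (ρ, ρ', c, c')) h)⟩
  have hterm : ∀ (ρ : Embedding G.toMultiGraph) (c c' : Bool),
      (∑ ρ' : Embedding H.toMultiGraph, if (F (ρ, ρ', c, c')).genus = k ∧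
        (SameCycle (F (ρ, ρ', c, c')).next (root G H) ((graph G H).rev (root G H)) ↔ b)
          then 1 else 0) = if SameCycle ρ.next (P c) (Q c') then
            H.straightCount b (k - ρ.genus) else H.twistCount b (k - ρ.genus) := by
    intro ρ c c'
    split_ifs with h
    · refine Finset.sum_congr rfl fun ρ' _ => ?_
      have h1 := hF (ρ, ρ', c, c')
      rw [genus_of_sameCycle (hP c) (hQ c') h1 h, rev_root_eq, root_eq,
        sameCycle_next_of_sameCycle (hP c) (hQ c') h1 h]
      simp only [eq_sub_iff_add_eq, add_comm]
    · refine Finset.sum_congr rfl fun ρ' _ => ?_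
      have h1 := hF (ρ, ρ', c, c')
      rw [genus_of_not_sameCycle (hP c) (hQ c') h1 h, rev_root_eq, root_eq,
        sameCycle_next_of_not_sameCycle h1 h]
      simp only [eq_sub_iff_add_eq, add_comm]
  rw [← Equiv.sum_comp (Equiv.ofBijective F hbij)]
  simp only [Equiv.ofBijective_apply, Fintype.sum_prod_type]
  refine Finset.sum_congr rfl fun ρ _ => ?_
  simp only [Fintype.sum_bool, Finset.sum_add_distrib, hterm]
  -- The pairs (e, x') and (x, rev e) are consecutive on a face and always share it. The pairs (e,
  -- rev e) and (x, x') share one exactly at type S, whence the coefficients 4 and 2, 2.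
  simp only [P, Q, cond_true, cond_false, sameCycle_e_other hx', sameCycle_other_rev_e hx,
    sameCycle_other_other hx hx', if_true]
  split_ifs <;> ring

end Amalgam

/-! ### The support of the interleaved counts. -/

namespace DoublyEdgeRooted

open Equiv Equiv.Perm MultiGraph

open scoped Classical

variable (H : DoublyEdgeRooted)

/-- The interleaving of the numbers of embeddings by twisted genus and by genus. -/
noncomputable def interleavedCount (b : Prop) : ℤ → ℕ :=
  interleave (H.twistCount b) (H.straightCount b)

theorem exists_of_interleavedCount_ne_zero {b : Prop} {p : ℤ} (h : H.interleavedCount b p ≠ 0) :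
    ∃ ρ : Embedding H.toMultiGraph, p = 2 * ρ.twistGenus H.g ∨ p = 2 * ρ.genus + 1 := by
  obtain ⟨t, rfl | rfl⟩ := Int.even_or_odd' p
  · rw [interleavedCount, interleave_two_mul] at h
    obtain ⟨ρ, -, hρ⟩ := Finset.exists_ne_zero_of_sum_ne_zero h
    refine ⟨ρ, Or.inl ?_⟩
    rw [(ite_ne_right_iff.1 hρ).1.1]
  · rw [interleavedCount, interleave_two_mul_add_one] at h
    obtain ⟨ρ, -, hρ⟩ := Finset.exists_ne_zero_of_sum_ne_zero h
    refine ⟨ρ, Or.inr ?_⟩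
    rw [(ite_ne_right_iff.1 hρ).1.1]

theorem finite_support_interleavedCount (b : Prop) : (H.interleavedCount b).support.Finite := by
  refine ((Set.finite_range fun ρ : Embedding H.toMultiGraph => 2 * ρ.twistGenus H.g).union
    (Set.finite_range fun ρ : Embedding H.toMultiGraph => 2 * ρ.genus + 1)).subset ?_
  intro p hp
  obtain ⟨ρ, h | h⟩ := H.exists_of_interleavedCount_ne_zero hp
  · exact Or.inl ⟨ρ, h.symm⟩
  · exact Or.inr ⟨ρ, h.symm⟩

theorem interleavedCount_add_ne_zero_iff (p : ℤ) :
    (H.interleavedCount False + H.interleavedCount True) p ≠ 0 ↔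
      ∃ ρ : Embedding H.toMultiGraph, p = 2 * ρ.twistGenus H.g ∨ p = 2 * ρ.genus + 1 := by
  constructor
  · intro h
    rw [Pi.add_apply, Ne, add_eq_zero, not_and_or] at h
    rcases h with h | h <;> exact H.exists_of_interleavedCount_ne_zero h
  · rintro ⟨ρ, rfl | rfl⟩
    · simp only [interleavedCount, Pi.add_apply, interleave_two_mul, twistCount,
        ← Finset.sum_add_distrib]
      intro h
      have := Finset.sum_eq_zero_iff.1 h ρ (Finset.mem_univ _)
      by_cases hs : SameCycle (ρ.twist H.g) H.f (H.rev H.f) <;> simp [hs] at this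
    · simp only [interleavedCount, Pi.add_apply, interleave_two_mul_add_one, straightCount,
        ← Finset.sum_add_distrib]
      intro h
      have := Finset.sum_eq_zero_iff.1 h ρ (Finset.mem_univ _)
      by_cases hs : SameCycle ρ.next H.f (H.rev H.f) <;> simp [hs] at this

/-- Even positions are filled by interpolating twisted genera and odd ones by interpolating genera.
As the twisted genus is the genus or one more, two embeddings realising the outer positions bound
either quantity. -/
theorem noInternalZeros_interleavedCount_add :
    NoInternalZeros (H.interleavedCount False + H.interleavedCount True) := by
  intro i k j hik hkj hij
  obtain ⟨hi, hj⟩ := mul_ne_zero_iff.1 hij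
  rw [interleavedCount_add_ne_zero_iff] at hi hj ⊢
  obtain ⟨ρ₁, h₁⟩ := hi
  obtain ⟨ρ₂, h₂⟩ := hj
  have e₁ := ρ₁.twistGenus_eq_or H.g
  have e₂ := ρ₂.twistGenus_eq_or H.g
  obtain ⟨t, rfl | rfl⟩ := Int.even_or_odd' k
  · obtain ⟨ρ, hρ⟩ := Embedding.exists_twistGenus_eq H.g ρ₁ ρ₂ t (by omega) (by omega)
    exact ⟨ρ, Or.inl (by rw [hρ])⟩
  · obtain ⟨ρ, hρ⟩ := Embedding.exists_genus_eq ρ₁ ρ₂ t (by omega) (by omega)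
    exact ⟨ρ, Or.inr (by rw [hρ])⟩

end DoublyEdgeRooted

/-! ### The recurrence as a sum over the interleaved index. -/

namespace Amalgam

open Equiv Equiv.Perm MultiGraph

open scoped Classical

variable {G : EdgeRooted} {H : DoublyEdgeRooted}

theorem amalgamRow_eq_sum (p k : ℤ) : amalgamRow G.D G.S p k =
    ∑ ρ : Embedding G.toMultiGraph, if SameCycle ρ.next G.e (G.rev G.e)
      then (if p = 2 * (k - ρ.genus) + 1 then 4 else 0)
      else ((if p = 2 * (k - ρ.genus) then 2 else 0) +
        (if p = 2 * (k - ρ.genus) + 1 then 2 else 0)) := by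
  unfold amalgamRow
  obtain ⟨t, rfl | rfl⟩ := Int.even_or_odd' p
  · rw [interleave_two_mul, G.D_eq, Finset.mul_sum]
    refine Finset.sum_congr rfl fun ρ _ => ?_
    have h1 : 2 * t ≠ 2 * (k - ρ.genus) + 1 := by omega
    have h2 : 2 * t = 2 * (k - ρ.genus) ↔ ρ.genus = k - t := by omega
    by_cases hs : SameCycle ρ.next G.e (G.rev G.e) <;> simp [hs, h1, h2]
  · rw [interleave_two_mul_add_one, G.D_eq, G.S_eq, Finset.mul_sum, Finset.mul_sum,
      ← Finset.sum_add_distrib]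
    refine Finset.sum_congr rfl fun ρ _ => ?_
    have h1 : 2 * t + 1 ≠ 2 * (k - ρ.genus) := by omega
    have h2 : 2 * t + 1 = 2 * (k - ρ.genus) + 1 ↔ ρ.genus = k - t := by omega
    by_cases hs : SameCycle ρ.next G.e (G.rev G.e) <;> simp only [hs, h1, h2] <;> simp

theorem sum_embedding_graph_eq_finsum (b : Prop) (k : ℤ) :
    (∑ ρW : Embedding (graph G H), if ρW.genus = k ∧
      (SameCycle ρW.next (root G H) ((graph G H).rev (root G H)) ↔ b) then 1 else 0) =
    ∑ᶠ p, H.interleavedCount b p * amalgamRow G.D G.S p k := by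
  rw [sum_embedding_graph]
  simp only [amalgamRow_eq_sum, Finset.mul_sum]
  rw [finsum_sum_comm _ _ fun ρ _ => (H.finite_support_interleavedCount b).subset
    fun p hp => left_ne_zero_of_mul hp]
  refine Finset.sum_congr rfl fun ρ _ => ?_
  have hne : 2 * (k - ρ.genus) ≠ 2 * (k - ρ.genus) + 1 := by omega
  rw [finsum_eq_sum_of_support_subset (s := {2 * (k - ρ.genus), 2 * (k - ρ.genus) + 1})]
  · rw [Finset.sum_pair hne, DoublyEdgeRooted.interleavedCount, interleave_two_mul,
      interleave_two_mul_add_one]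
    split_ifs <;> simp_all [mul_comm]
  · intro p hp
    by_contra h
    simp only [Finset.coe_insert, Finset.coe_singleton, Set.mem_insert_iff,
      Set.mem_singleton_iff, not_or] at h
    simp [h.1, h.2] at hp

end Amalgam

/-- The recurrence for the partial genus distributions of an edge-amalgamation. -/
theorem D_amalgam (G : EdgeRooted) (H : DoublyEdgeRooted) : (amalgam G H).D =
    fun k => ∑ᶠ p, interleave H.A1 H.A2 p * amalgamRow G.D G.S p k := by
  funext k
  rw [EdgeRooted.D_eq, H.A1_eq, H.A2_eq]
  refine Eq.trans ?_ (Amalgam.sum_embedding_graph_eq_finsum False k)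
  exact Finset.sum_congr rfl fun ρ _ => by congr

theorem S_amalgam (G : EdgeRooted) (H : DoublyEdgeRooted) : (amalgam G H).S =
    fun k => ∑ᶠ p, interleave H.B1 H.B2 p * amalgamRow G.D G.S p k := by
  funext k
  rw [EdgeRooted.S_eq, H.B1_eq, H.B2_eq]
  refine Eq.trans ?_ (Amalgam.sum_embedding_graph_eq_finsum True k)
  exact Finset.sum_congr rfl fun ρ _ => by congr

theorem interleave_ne_zero {a₁ a₂ : ℤ → ℕ} (h : a₁ ≠ 0 ∨ a₂ ≠ 0) : interleave a₁ a₂ ≠ 0 := by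
  intro h0
  rcases h with h | h
  · exact h (funext fun t => by rw [← interleave_two_mul a₁ a₂ t, h0]; rfl)
  · exact h (funext fun t => by rw [← interleave_two_mul_add_one a₁ a₂ t, h0]; rfl)

/-- The absence of internal zeros comes from interpolation for every embedded graph, so
ratio-dominance is all that the induction along the chain has to carry. -/
theorem ratioDominated_amalgam {G : EdgeRooted} {H : DoublyEdgeRooted}
    (hG : RatioDominated G.D G.S) (hlex : LexCondition H.A1 H.A2 H.B1 H.B2)
    (hA : H.A1 ≠ 0 ∨ H.A2 ≠ 0) (hB : H.B1 ≠ 0 ∨ H.B2 ≠ 0) :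
    RatioDominated (amalgam G H).D (amalgam G H).S := by
  rw [D_amalgam, S_amalgam]
  have hA' : interleave H.A1 H.A2 = H.interleavedCount False := by rw [H.A1_eq, H.A2_eq]; rfl
  have hB' : interleave H.B1 H.B2 = H.interleavedCount True := by rw [H.B1_eq, H.B2_eq]; rfl
  refine hG.finsum_amalgamRow ?_ hlex.mul_le_succ hlex.mul_le_succ_offset ?_
    (interleave_ne_zero hA) (interleave_ne_zero hB) ?_ ?_
  · rw [G.D_add_S]; exact G.noInternalZeros_genusDist
  · rw [hA', hB']; exact H.noInternalZeros_interleavedCount_add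
  · rw [hA']; exact H.finite_support_interleavedCount _
  · rw [hB']; exact H.finite_support_interleavedCount _

theorem ratioDominated_chain (Hs : List DoublyEdgeRooted) (G : EdgeRooted)
    (hG : RatioDominated G.D G.S) (hlex : ∀ H ∈ Hs, LexCondition H.A1 H.A2 H.B1 H.B2)
    (hA : ∀ H ∈ Hs, H.A1 ≠ 0 ∨ H.A2 ≠ 0) (hB : ∀ H ∈ Hs, H.B1 ≠ 0 ∨ H.B2 ≠ 0) :
    RatioDominated (chain G Hs).D (chain G Hs).S := by
  induction Hs generalizing G with
  | nil => exact hG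
  | cons H Hs ih =>
    simp only [List.forall_mem_cons] at hlex hA hB
    exact ih (amalgam G H) (ratioDominated_amalgam hG hlex.1 hA.1 hB.1) hlex.2 hA.2 hB.2

theorem mainTheorem2 (G : EdgeRooted) (Hs : List DoublyEdgeRooted)
    (hG : RatioDominated G.D G.S)
    (hlex : ∀ H ∈ Hs, LexCondition H.A1 H.A2 H.B1 H.B2)
    (hA : ∀ H ∈ Hs, H.A1 ≠ 0 ∨ H.A2 ≠ 0)
    (hB : ∀ H ∈ Hs, H.B1 ≠ 0 ∨ H.B2 ≠ 0) :
    (LogConcave (chain G Hs).D ∧ NoInternalZeros (chain G Hs).D) ∧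
    (LogConcave (chain G Hs).S ∧ NoInternalZeros (chain G Hs).S) ∧
    RatioDominated (chain G Hs).D (chain G Hs).S ∧
    (LogConcave (chain G Hs).genusDist ∧ NoInternalZeros (chain G Hs).genusDist) := by
  have h := ratioDominated_chain Hs G hG hlex hA hB
  have hz : NoInternalZeros ((chain G Hs).D + (chain G Hs).S) := by
    rw [EdgeRooted.D_add_S]; exact (chain G Hs).noInternalZeros_genusDist
  refine ⟨⟨h.1.1, h.noInternalZeros_left hz⟩, ⟨h.1.2.1, h.noInternalZeros_right hz⟩, h, ?_,
    (chain G Hs).noInternalZeros_genusDist⟩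
  rw [← EdgeRooted.D_add_S]
  exact h.logConcave_add
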